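/- For positive integers $n,d,k,r$, let $[n]=\{1,\dots,n\}$ and let $A(n,d,k,r)$ denote the number of ordered $r$-tuples of points of $[n]^d$ all of whose points lie in a common $k$-dimensional affine subspace of $\mathbb{R}^d$. Let $d,k,r$ be positive integers with $k<d$ and $r\ge k+2$. Then, as $n\to\infty$, with implied constants depending only on $d,k,r$, $$A(n,d,k,r)=\begin{cases}\Theta\!\left(n^{d+k\cdot\max\{r-1,\,d\}}\right), & \text{if } r-1\ne d,\\[2pt] \Theta\!\left(n^{d(k+1)}\log n\right), & \text{if } r-1=d.\end{cases}$$ This holds both when the points of a tuple are allowed to coincide and when they are required to be pairwise distinct. -/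

import Mathlib

open Filter Asymptotics

/-- The lattice cube `[n]^d`, where `[n] = {1, …, n}`. -/
noncomputable def latticeCube (n d : ℕ) : Finset (Fin d → ℤ) :=
  Fintype.piFinset fun _ : Fin d => Finset.Icc (1 : ℤ) (n : ℤ)

/-- The points `p 0, …, p (r - 1)` all lie in one `k`-dimensional affine subspace of `ℝ^d`. -/
def LiesInAffine {d r : ℕ} (k : ℕ) (p : Fin r → Fin d → ℤ) : Prop :=
  ∃ S : AffineSubspace ℝ (Fin d → ℝ), (S : Set (Fin d → ℝ)).Nonempty ∧
    Module.finrank ℝ S.direction = k ∧ ∀ i, (fun j => ((p i j : ℤ) : ℝ)) ∈ S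

open scoped Classical in
/-- The ordered `r`-tuples of points of `[n]^d`, repetitions allowed, that lie in a
`k`-dimensional affine subspace. -/
noncomputable def affineTuples (n d k r : ℕ) : Finset (Fin r → Fin d → ℤ) :=
  (Fintype.piFinset fun _ : Fin r => latticeCube n d).filter fun p => LiesInAffine k p

open scoped Classical in
/-- The ordered `r`-tuples of pairwise distinct points of `[n]^d` that lie in a
`k`-dimensional affine subspace. -/
noncomputable def affineInjTuples (n d k r : ℕ) : Finset (Fin r → Fin d → ℤ) :=
  (affineTuples n d k r).filter fun p => Function.Injective p

/-- The growth rate `a_{d,k,r}(n)`. -/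
noncomputable def affineRate (d k r n : ℕ) : ℝ :=
  if r - 1 ≠ d then (n : ℝ) ^ (d + k * max (r - 1) d)
  else (n : ℝ) ^ (d * (k + 1)) * Real.log n

/-! Put `m = r - 1`. Subtracting the first point turns a tuple into `m` differences in a lattice of
rank at most `k`.

Upper bound. In terms of reduced generators `b i`, the matrix of differences is a sum of `k` integer
matrices `c i ⊗ b i` with `|c i| |b i| = O(n)` (`exists_decomposition`). The number of pairs with
`|b| |c| ≤ N` is of order at most `∑ y ^ (d-1) (N/y) ^ m` over `1 ≤ y ≤ N`. This is `O(N ^ max m d)`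
for `m ≠ d` and `O(N ^ d log N)` for `m = d`. The `k`-th power, times `n ^ d` for the first point,
settles `m ≠ d`, but for `m = d` it would give `log ^ k`. There the other vectors are reduced modulo
the shortest one, `b 0`, at a coordinate where `b 0` attains its sup norm `x`
(`exists_reduced_decomposition`). Each of them then lies in a slab of width `x`, and the sum becomes
`N ^ d ∑ x / y ^ 2` over `y ≥ x`, which is `O(N ^ d)` (`card_slab_pairs_le`). Only `b 0` contributes
a logarithm.

Lower bound. For `m > d`, take points in translates of one coordinate subspace. For `m < d`, take `k
- 1` free points and an arithmetic progression. For `m = d`, sum over denominators `q`: choose `k`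
independent vectors of which a combination `(1, c)` is divisible by `q`, and let the remaining `d -
k` points have coordinates in `(1/q) ℤ` along these vectors. Each `q` contributes a multiple of
`φ(q) / q ^ 2`, whose sum is logarithmic (`sum_totient_le_card_affineTuples`). Independence and
lowest terms rule out double counting. Tuples with a repeated point come from `d`-tuples, for which
there is no logarithm, so they are negligible. -/

/-! ### Lattice reduction -/

/-- A discrete subgroup of a Euclidean space is generated by vectors for which the coefficients
of each element are controlled by its norm. -/
theorem exists_reduced_generators {E : Type*} [NormedAddCommGroup E] [InnerProductSpace ℝ E]
    [FiniteDimensional ℝ E] (k : ℕ) :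
    ∃ C : ℝ, 0 ≤ C ∧ ∀ L : AddSubgroup E, (∀ R : ℝ, {x | x ∈ L ∧ ‖x‖ ≤ R}.Finite) →
      Module.finrank ℝ (Submodule.span ℝ (L : Set E)) ≤ k →
      ∃ b : Fin k → E, (∀ i, b i ∈ L) ∧ ∀ v ∈ L, ∃ c : Fin k → ℤ,
        v = ∑ i, c i • b i ∧ ∀ i, |(c i : ℝ)| * ‖b i‖ ≤ C * ‖v‖ := by
  induction k with
  | zero =>
    refine ⟨0, le_rfl, fun L _ hL => ⟨fun i => 0, fun i => L.zero_mem, fun v hv => ⟨0, ?_, ?_⟩⟩⟩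
    · have h0 : Submodule.span ℝ (L : Set E) = ⊥ :=
        Submodule.finrank_eq_zero.mp (Nat.le_zero.mp hL)
      have : v ∈ Submodule.span ℝ (L : Set E) := Submodule.subset_span hv
      rw [h0, Submodule.mem_bot] at this
      simp [this]
    · intro i; exact i.elim0
  | succ k ih =>
    obtain ⟨C, hC, ih⟩ := ih
    -- Lifted generators cost `2 * C`; the coefficient of the shortest vector costs `1 + k * (2 *
    -- C)`, by the triangle inequality.
    refine ⟨2 * C + 1 + k * (2 * C), by positivity, fun L hfin hL => ?_⟩
    by_cases htriv : ∀ x ∈ L, x = 0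
    · refine ⟨0, fun i => L.zero_mem, fun v hv => ⟨0, by simp [htriv v hv], fun i => ?_⟩⟩
      simp; positivity
    push Not at htriv
    obtain ⟨x0, hx0L, hx0⟩ := htriv
    obtain ⟨a, ⟨⟨haL, ha0⟩, -⟩, hamin⟩ : ∃ a, ((a ∈ L ∧ a ≠ 0) ∧ ‖a‖ ≤ ‖x0‖) ∧
        ∀ x, x ∈ L → x ≠ 0 → ‖a‖ ≤ ‖x‖ := by
      have hf : {x | (x ∈ L ∧ x ≠ 0) ∧ ‖x‖ ≤ ‖x0‖}.Finite :=
        (hfin ‖x0‖).subset fun x hx => ⟨hx.1.1, hx.2⟩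
      obtain ⟨a, ha, hmin⟩ := hf.exists_minimalFor (fun x => ‖x‖) _ ⟨x0, ⟨hx0L, hx0⟩, le_rfl⟩
      refine ⟨a, ha, fun x hxL hx => ?_⟩
      by_contra hlt
      push Not at hlt
      exact absurd (hmin (j := x) ⟨⟨hxL, hx⟩, hlt.le.trans ha.2⟩ hlt.le) (not_le.mpr hlt)
    have hapos : 0 < ‖a‖ := norm_pos_iff.mpr ha0
    set P : E →L[ℝ] E := (ℝ ∙ a)ᗮ.starProjection with hP
    have hPsub : ∀ x, ∃ t : ℝ, x = P x + t • a := by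
      intro x
      have h1 := (ℝ ∙ a).starProjection_add_starProjection_orthogonal x
      have h2 : (ℝ ∙ a).starProjection x ∈ (ℝ ∙ a) := Submodule.starProjection_apply_mem _ _
      obtain ⟨t, ht⟩ := Submodule.mem_span_singleton.mp h2
      exact ⟨t, by rw [ht, add_comm]; exact h1.symm⟩
    have hPle : ∀ x, ‖P x‖ ≤ ‖x‖ := fun x => Submodule.norm_starProjection_apply_le _ _
    have hPa : P a = 0 := by
      rw [hP, Submodule.starProjection_apply_eq_zero_iff, Submodule.orthogonal_orthogonal]
      exact Submodule.mem_span_singleton_self a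
    -- Subtracting the nearest integer multiple of `a` leaves a component along `a` of length at
    -- most `‖a‖ / 2`. This gives both discreteness of the projected lattice and short lifts.
    have hlift : ∀ x ∈ L, ∃ y ∈ L, P y = P x ∧ ‖y‖ ≤ ‖P x‖ + ‖a‖ / 2 := by
      intro x hx
      obtain ⟨t, ht⟩ := hPsub x
      refine ⟨x - round t • a, L.sub_mem hx (L.zsmul_mem haL _), by simp [hPa], ?_⟩
      have : x - round t • a = P x + (t - round t) • a := by
        rw [sub_smul, Int.cast_smul_eq_zsmul]
        nth_rewrite 1 [ht]
        abel
      rw [this]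
      refine (norm_add_le _ _).trans ?_
      rw [norm_smul, Real.norm_eq_abs]
      have := abs_sub_round t
      nlinarith
    -- A lattice point on the line of `a` that is not a multiple of `a` would leave a nonzero
    -- remainder shorter than `a`.
    have hker : ∀ x ∈ L, P x = 0 → ∃ t : ℤ, x = t • a := by
      intro x hx h0
      obtain ⟨t, ht⟩ := hPsub x
      refine ⟨round t, ?_⟩
      by_contra hne
      have h1 : x - round t • a = (t - round t) • a := by
        rw [sub_smul, Int.cast_smul_eq_zsmul]
        nth_rewrite 1 [ht]
        rw [h0, zero_add]
      have h2 := hamin _ (L.sub_mem hx (L.zsmul_mem haL (round t))) (sub_ne_zero.mpr hne)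
      rw [h1, norm_smul, Real.norm_eq_abs] at h2
      have := abs_sub_round t
      nlinarith
    obtain ⟨b', hb'L, hb'⟩ := ih (L.map P.toLinearMap.toAddMonoidHom) (by
      intro R
      refine ((hfin (R + ‖a‖ / 2)).image P).subset ?_
      rintro _ ⟨⟨x, hx, rfl⟩, hR⟩
      obtain ⟨y, hyL, hyP, hy⟩ := hlift x hx
      exact ⟨y, ⟨hyL, hy.trans (by gcongr; exact hR)⟩, hyP⟩) (by
      have hspan : Submodule.span ℝ ((L.map P.toLinearMap.toAddMonoidHom : AddSubgroup E) : Set E)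
          = LinearMap.range (P.toLinearMap.domRestrict (Submodule.span ℝ (L : Set E))) := by
        rw [LinearMap.range_domRestrict, Submodule.map_span]
        rfl
      rw [hspan]
      have h1 := LinearMap.finrank_range_add_finrank_ker
        (P.toLinearMap.domRestrict (Submodule.span ℝ (L : Set E)))
      have h2 : 0 < Module.finrank ℝ
          (LinearMap.ker (P.toLinearMap.domRestrict (Submodule.span ℝ (L : Set E)))) := by
        rw [Module.finrank_pos_iff_exists_ne_zero]
        refine ⟨⟨⟨a, Submodule.subset_span haL⟩, ?_⟩, ?_⟩
        · simpa using hPa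
        · simpa using ha0
      omega)
    -- A nonzero lift satisfies `‖a‖ ≤ ‖y‖ ≤ ‖b' i‖ + ‖a‖ / 2`, whence the factor 2.
    have hb : ∀ i, ∃ y ∈ L, P y = b' i ∧ ‖y‖ ≤ 2 * ‖b' i‖ := by
      intro i
      by_cases h0 : b' i = 0
      · exact ⟨0, L.zero_mem, by simp [h0], by simp⟩
      obtain ⟨x, hx, hxb⟩ := hb'L i
      obtain ⟨y, hyL, hyP, hy⟩ := hlift x hx
      have hPx : P x = b' i := hxb
      rw [hPx] at hyP hy
      have hy0 : y ≠ 0 := by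
        rintro rfl
        exact h0 (by rw [← hyP, map_zero])
      have := hamin y hyL hy0
      exact ⟨y, hyL, hyP, by linarith⟩
    choose b hbL hbP hbn using hb
    refine ⟨Fin.cons a b, fun i => ?_, fun v hv => ?_⟩
    · refine Fin.cases ?_ (fun j => ?_) i
      · simpa using haL
      · simpa using hbL j
    obtain ⟨c, hc, hcb⟩ := hb' (P v) ⟨v, hv, rfl⟩
    have hcb2 : ∀ i, |(c i : ℝ)| * ‖b i‖ ≤ 2 * C * ‖v‖ := by
      intro i
      calc |(c i : ℝ)| * ‖b i‖ ≤ |(c i : ℝ)| * (2 * ‖b' i‖) := by gcongr; exact hbn i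
        _ = 2 * (|(c i : ℝ)| * ‖b' i‖) := by ring
        _ ≤ 2 * (C * ‖P v‖) := mul_le_mul_of_nonneg_left (hcb i) zero_le_two
        _ ≤ 2 * (C * ‖v‖) := by gcongr; exact hPle v
        _ = _ := by ring
    obtain ⟨t, ht⟩ := hker (v - ∑ i, c i • b i)
      (L.sub_mem hv (L.sum_mem fun i _ => L.zsmul_mem (hbL i) _)) (by
        rw [map_sub, map_sum, sub_eq_zero]
        simpa [hbP] using hc)
    refine ⟨Fin.cons t c, ?_, fun i => ?_⟩
    · rw [Fin.sum_univ_succ]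
      simp only [Fin.cons_zero, Fin.cons_succ]
      rw [← ht]; abel
    · refine Fin.cases ?_ (fun j => ?_) i
      · simp only [Fin.cons_zero]
        have h1 : |(t : ℝ)| * ‖a‖ = ‖v - ∑ i, c i • b i‖ := by
          rw [ht, ← Int.cast_smul_eq_zsmul ℝ, norm_smul, Real.norm_eq_abs]
        have h2 : ‖∑ i, c i • b i‖ ≤ k * (2 * C * ‖v‖) := by
          refine (norm_sum_le _ _).trans ?_
          refine (Finset.sum_le_card_nsmul _ _ (2 * C * ‖v‖) fun i _ => ?_).trans (by simp)
          rw [← Int.cast_smul_eq_zsmul ℝ, norm_smul, Real.norm_eq_abs]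
          exact hcb2 i
        rw [h1]
        have := norm_sub_le v (∑ i, c i • b i)
        have : 0 ≤ C * ‖v‖ := by positivity
        nlinarith
      · simp only [Fin.cons_succ]
        refine (hcb2 j).trans ?_
        have : 0 ≤ C * ‖v‖ := by positivity
        have : 0 ≤ (k : ℝ) * (C * ‖v‖) := by positivity
        nlinarith [norm_nonneg v]

/-! ### Integer vectors and decomposition into matrices of rank one -/

/-- The sup norm of an integer vector. -/
def supNorm {d : ℕ} (b : Fin d → ℤ) : ℕ := Finset.univ.sup fun i => (b i).natAbs

theorem natAbs_le_supNorm {d : ℕ} (b : Fin d → ℤ) (i : Fin d) : (b i).natAbs ≤ supNorm b :=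
  Finset.le_sup (f := fun i => (b i).natAbs) (Finset.mem_univ i)

theorem supNorm_le_iff {d : ℕ} {b : Fin d → ℤ} {N : ℕ} :
    supNorm b ≤ N ↔ ∀ i, (b i).natAbs ≤ N := by
  simp [supNorm]

theorem exists_natAbs_eq_supNorm {d : ℕ} (b : Fin d → ℤ) (hb : 1 ≤ supNorm b) :
    ∃ i, (b i).natAbs = supNorm b := by
  rcases Nat.eq_zero_or_pos d with rfl | hd
  · simp [supNorm] at hb
  obtain ⟨i, -, hi⟩ := Finset.exists_mem_eq_sup Finset.univ
    (⟨⟨0, hd⟩, Finset.mem_univ _⟩ : (Finset.univ : Finset (Fin d)).Nonempty)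
    fun i => (b i).natAbs
  exact ⟨i, hi.symm⟩

theorem supNorm_eq_zero {d : ℕ} {b : Fin d → ℤ} : supNorm b = 0 ↔ b = 0 := by
  rw [← Nat.le_zero, supNorm_le_iff]
  simp [funext_iff]

/-- The embedding of integer vectors into Euclidean space. -/
noncomputable def intToEuclidean (d : ℕ) : (Fin d → ℤ) →+ EuclideanSpace ℝ (Fin d) where
  toFun z := WithLp.toLp 2 fun l => (z l : ℝ)
  map_zero' := by ext; simp
  map_add' x y := by ext; simp

@[simp] theorem intToEuclidean_apply {d : ℕ} (z : Fin d → ℤ) (l : Fin d) :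
    intToEuclidean d z l = z l := rfl

theorem supNorm_le_norm_intToEuclidean {d : ℕ} (z : Fin d → ℤ) :
    (supNorm z : ℝ) ≤ ‖intToEuclidean d z‖ := by
  rcases Nat.eq_zero_or_pos (supNorm z) with h | h
  · simp [h]
  obtain ⟨i, hi⟩ := exists_natAbs_eq_supNorm z h
  rw [← hi, Nat.cast_natAbs, Int.cast_abs]
  simpa using PiLp.norm_apply_le (intToEuclidean d z) i

theorem norm_intToEuclidean_le {d : ℕ} (z : Fin d → ℤ) :
    ‖intToEuclidean d z‖ ≤ d * supNorm z := by
  refine le_of_sq_le_sq ?_ (by positivity)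
  rw [EuclideanSpace.norm_sq_eq]
  have h1 : ∀ l ∈ Finset.univ, ‖intToEuclidean d z l‖ ^ 2 ≤ (supNorm z : ℝ) ^ 2 := by
    intro l _
    rw [intToEuclidean_apply, Real.norm_eq_abs, ← Int.cast_abs, ← Nat.cast_natAbs]
    gcongr
    exact natAbs_le_supNorm z l
  refine (Finset.sum_le_card_nsmul _ _ _ h1).trans ?_
  rw [Finset.card_univ, Fintype.card_fin, nsmul_eq_mul, mul_pow]
  gcongr
  rcases Nat.eq_zero_or_pos d with rfl | hd
  · simp
  · have : (1 : ℝ) ≤ d := by exact_mod_cast hd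
    nlinarith

theorem finite_intToEuclidean_ball (d : ℕ) (R : ℝ) :
    {x | x ∈ (intToEuclidean d).range ∧ ‖x‖ ≤ R}.Finite := by
  refine ((Fintype.piFinset fun _ : Fin d =>
    Finset.Icc (-(⌊R⌋₊ : ℤ)) ⌊R⌋₊).finite_toSet.image (intToEuclidean d)).subset ?_
  rintro _ ⟨⟨z, rfl⟩, hz⟩
  refine ⟨z, ?_, rfl⟩
  have h : supNorm z ≤ ⌊R⌋₊ := Nat.le_floor ((supNorm_le_norm_intToEuclidean z).trans hz)
  rw [supNorm_le_iff] at h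
  simp only [Finset.mem_coe, Fintype.mem_piFinset, Finset.mem_Icc]
  intro l
  have := h l
  omega

/-- The differences of a tuple of points of a `k`-dimensional affine subspace form a sum of `k`
integer matrices of rank at most one whose row and column sizes have a controlled product. -/
theorem exists_decomposition (d k : ℕ) (hd : 1 ≤ d) : ∃ K : ℕ, 1 ≤ K ∧ ∀ (n m : ℕ), 1 ≤ n →
    ∀ p : Fin (m + 1) → Fin d → ℤ, (∀ i, p i ∈ latticeCube n d) → LiesInAffine k p →
    ∃ (b : Fin k → Fin d → ℤ) (c : Fin k → Fin m → ℤ),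
      (∀ j l, p j.succ l - p 0 l = ∑ i, c i j * b i l) ∧
      (∀ i, 1 ≤ supNorm (b i) ∧ supNorm (b i) ≤ K * n) ∧
      ∀ i j, (c i j).natAbs * supNorm (b i) ≤ K * n := by
  obtain ⟨C, hC, hred⟩ := exists_reduced_generators (E := EuclideanSpace ℝ (Fin d)) k
  obtain ⟨K, hK⟩ := exists_nat_ge (C * d)
  refine ⟨K + 1, by omega, ?_⟩
  rintro n m hn p hp ⟨S, -, hSk, hpS⟩
  set W : Submodule ℝ (EuclideanSpace ℝ (Fin d)) :=
    S.direction.map (WithLp.linearEquiv 2 ℝ (Fin d → ℝ)).symm.toLinearMap with hW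
  obtain ⟨b, hbL, hb⟩ := hred ((intToEuclidean d).range ⊓ W.toAddSubgroup)
    (fun R => (finite_intToEuclidean_ball d R).subset fun x hx => ⟨hx.1.1, hx.2⟩) (by
      have h1 : Submodule.span ℝ
          (((intToEuclidean d).range ⊓ W.toAddSubgroup : AddSubgroup _) :
            Set (EuclideanSpace ℝ (Fin d))) ≤ W := by
        rw [Submodule.span_le]
        exact fun x hx => hx.2
      refine (Submodule.finrank_mono h1).trans ?_
      rw [← hSk]
      exact Submodule.finrank_map_le _ _)
  have hb1 : ∀ i, ∃ z, intToEuclidean d z = b i := fun i => (hbL i).1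
  choose z hz using hb1
  have hdiff : ∀ j : Fin m, intToEuclidean d (p j.succ - p 0) ∈
      (intToEuclidean d).range ⊓ W.toAddSubgroup := by
    intro j
    refine ⟨⟨_, rfl⟩, ?_⟩
    refine ⟨_, AffineSubspace.vsub_mem_direction (hpS j.succ) (hpS 0), ?_⟩
    ext l
    simp [WithLp.linearEquiv]
  choose c hc hcb using fun j => hb _ (hdiff j)
  have hsup : ∀ j : Fin m, supNorm (p j.succ - p 0) ≤ n := by
    intro j
    rw [supNorm_le_iff]
    intro l
    have h1 := hp j.succ
    have h2 := hp 0
    simp only [latticeCube, Fintype.mem_piFinset, Finset.mem_Icc] at h1 h2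
    have := h1 l
    have := h2 l
    simp only [Pi.sub_apply]
    omega
  have hcz : ∀ i j, (c j i).natAbs * supNorm (z i) ≤ K * n := by
    intro i j
    have h1 : ((c j i).natAbs : ℝ) * supNorm (z i) ≤ K * n := by
      calc ((c j i).natAbs : ℝ) * supNorm (z i) ≤ |(c j i : ℝ)| * ‖b i‖ := by
            rw [Nat.cast_natAbs, Int.cast_abs, ← hz i]
            gcongr
            exact supNorm_le_norm_intToEuclidean _
        _ ≤ C * ‖intToEuclidean d (p j.succ - p 0)‖ := hcb j i
        _ ≤ C * (d * n) := by
            gcongr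
            refine (norm_intToEuclidean_le _).trans ?_
            gcongr
            exact hsup j
        _ = (C * d) * n := by ring
        _ ≤ K * n := by gcongr
    exact_mod_cast h1
  have hsum : ∀ j l, p j.succ l - p 0 l = ∑ i, c j i * z i l := by
    intro j l
    have h1 := congrArg (fun x => x l) (hc j)
    simp only [← hz, ← map_zsmul, ← map_sum, intToEuclidean_apply, Int.cast_inj] at h1
    simpa [Finset.sum_apply] using h1
  classical
  -- Zero or unused generators are replaced by a unit vector with zero coefficients, so that all
  -- norms lie between `1` and a multiple of `n`. A generator that is kept has a nonzero
  -- coefficient, which bounds its norm.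
  set good : Fin k → Prop := fun i => z i ≠ 0 ∧ ∃ j, c j i ≠ 0 with hgood
  refine ⟨fun i => if good i then z i else Pi.single ⟨0, hd⟩ 1,
    fun i j => if good i then c j i else 0, ?_, ?_, ?_⟩
  · intro j l
    rw [hsum]
    refine Finset.sum_congr rfl fun i _ => ?_
    by_cases h : good i
    · simp [h]
    · simp only [h, if_false, zero_mul]
      simp only [hgood, not_and_or, not_not, not_exists] at h
      rcases h with h | h
      · simp [h]
      · simp [h j]
  · intro i
    by_cases h : good i
    · simp only [h, if_true]
      have h1 : 1 ≤ supNorm (z i) := Nat.one_le_iff_ne_zero.mpr fun h0 => h.1 (supNorm_eq_zero.mp h0)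
      obtain ⟨j, hj⟩ := h.2
      refine ⟨h1, ?_⟩
      have h2 := hcz i j
      have h3 : 1 ≤ (c j i).natAbs := by omega
      nlinarith
    · simp only [h, if_false]
      have h1 : supNorm (Pi.single (⟨0, hd⟩ : Fin d) (1 : ℤ)) ≤ 1 := by
        rw [supNorm_le_iff]
        intro l
        by_cases hl : l = ⟨0, hd⟩
        · subst hl; simp
        · simp [hl]
      have h2 := natAbs_le_supNorm (Pi.single (⟨0, hd⟩ : Fin d) (1 : ℤ)) ⟨0, hd⟩
      simp only [Pi.single_eq_same, Int.natAbs_one] at h2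
      exact ⟨h2, by nlinarith⟩
  · intro i j
    by_cases h : good i
    · simp only [h, if_true]
      exact (hcz i j).trans (by gcongr; omega)
    · simp [h]

/-! ### Counting pairs of vectors -/

/-- Integer vectors of sup norm at most `N`. -/
noncomputable def intBox (d N : ℕ) : Finset (Fin d → ℤ) := Fintype.piFinset fun _ => Finset.Icc (-(N : ℤ)) N

theorem mem_intBox {d N : ℕ} {b : Fin d → ℤ} : b ∈ intBox d N ↔ supNorm b ≤ N := by
  rw [supNorm_le_iff]
  simp only [intBox, Fintype.mem_piFinset, Finset.mem_Icc]
  exact forall_congr' fun i => by omega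

theorem card_intBox (d N : ℕ) : (intBox d N).card = (2 * N + 1) ^ d := by
  simp only [intBox, Fintype.card_piFinset, Int.card_Icc, Finset.prod_const, Finset.card_univ,
    Fintype.card_fin]
  congr 1
  omega

theorem prod_le_mul_pow {d : ℕ} (g : Fin d → ℕ) (j : Fin d) {A M : ℕ} (hj : g j ≤ A)
    (h : ∀ l, l ≠ j → g l ≤ M) : ∏ l, g l ≤ A * M ^ (d - 1) := by
  rw [← Finset.mul_prod_erase _ _ (Finset.mem_univ j)]
  refine Nat.mul_le_mul hj ?_
  refine (Finset.prod_le_pow_card _ _ M fun l hl => h l (Finset.ne_of_mem_erase hl)).trans ?_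
  simp

theorem prod_le_mul_mul_pow {d : ℕ} (g : Fin d → ℕ) {j p : Fin d} (hjp : j ≠ p) {A B M : ℕ}
    (hj : g j ≤ A) (hp : g p ≤ B) (h : ∀ l, l ≠ j → l ≠ p → g l ≤ M) :
    ∏ l, g l ≤ A * (B * M ^ (d - 2)) := by
  rw [← Finset.mul_prod_erase _ _ (Finset.mem_univ j),
    ← Finset.mul_prod_erase _ _ (Finset.mem_erase.mpr ⟨hjp.symm, Finset.mem_univ p⟩)]
  refine Nat.mul_le_mul hj (Nat.mul_le_mul hp ?_)
  refine (Finset.prod_le_pow_card _ _ M fun l hl => ?_).trans ?_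
  · rw [Finset.mem_erase, Finset.mem_erase] at hl
    exact h l hl.2.1 hl.1
  · rw [Finset.card_erase_of_mem (Finset.mem_erase.mpr ⟨hjp.symm, Finset.mem_univ p⟩),
      Finset.card_erase_of_mem (Finset.mem_univ j), Finset.card_univ, Fintype.card_fin,
      Nat.sub_sub]

/-- Some coordinate is `±y`, and each of the others has `2 * y + 1 ≤ 3 * y` values. -/
theorem card_sphere_le (d N y : ℕ) (hy : 1 ≤ y) :
    ((intBox d N).filter fun b => supNorm b = y).card ≤ d * (2 * (3 * y) ^ (d - 1)) := by
  classical
  set F : Fin d → Finset (Fin d → ℤ) := fun j => Fintype.piFinset fun l =>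
    if l = j then {(y : ℤ), -(y : ℤ)} else Finset.Icc (-(y : ℤ)) y with hF
  have hsub : ((intBox d N).filter fun b => supNorm b = y) ⊆ Finset.univ.biUnion F := by
    intro b hb
    obtain ⟨-, hb⟩ := Finset.mem_filter.mp hb
    obtain ⟨j, hj⟩ := exists_natAbs_eq_supNorm b (by omega)
    refine Finset.mem_biUnion.mpr ⟨j, Finset.mem_univ _, Fintype.mem_piFinset.mpr fun l => ?_⟩
    split_ifs with h
    · subst h
      simp only [Finset.mem_insert, Finset.mem_singleton]
      omega
    · have := natAbs_le_supNorm b l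
      rw [Finset.mem_Icc]
      omega
  refine (Finset.card_le_card hsub).trans (Finset.card_biUnion_le.trans ?_)
  refine (Finset.sum_le_card_nsmul _ _ (2 * (3 * y) ^ (d - 1)) fun j _ => ?_).trans (by simp)
  rw [hF, Fintype.card_piFinset]
  refine prod_le_mul_pow _ j ?_ fun l hl => ?_
  · simpa using Finset.card_le_two
  · simp only [hl, if_false, Int.card_Icc]
    omega

/-- As `x < y`, the coordinate equal to `±y` is not `p`, so the restriction at `p` saves a factor `x
/ y` over the whole sphere. This saving removes the extra logarithms. -/
theorem card_sphere_slab_le (d N x y : ℕ) (p : Fin d) (hx : 1 ≤ x) (hxy : x < y) :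
    ((intBox d N).filter fun b => (b p).natAbs ≤ x ∧ supNorm b = y).card ≤
      d * (2 * ((3 * x) * (3 * y) ^ (d - 2))) := by
  classical
  set F : Fin d → Finset (Fin d → ℤ) := fun j => Fintype.piFinset fun l =>
    if l = j then {(y : ℤ), -(y : ℤ)} else if l = p then Finset.Icc (-(x : ℤ)) x
      else Finset.Icc (-(y : ℤ)) y with hF
  have hsub : ((intBox d N).filter fun b => (b p).natAbs ≤ x ∧ supNorm b = y) ⊆
      (Finset.univ.erase p).biUnion F := by
    intro b hb
    obtain ⟨-, hbp, hb⟩ := Finset.mem_filter.mp hb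
    obtain ⟨j, hj⟩ := exists_natAbs_eq_supNorm b (by omega)
    refine Finset.mem_biUnion.mpr ⟨j, Finset.mem_erase.mpr ⟨?_, Finset.mem_univ _⟩,
      Fintype.mem_piFinset.mpr fun l => ?_⟩
    · rintro rfl; omega
    split_ifs with h h'
    · subst h
      simp only [Finset.mem_insert, Finset.mem_singleton]
      omega
    · subst h'
      rw [Finset.mem_Icc]
      omega
    · have := natAbs_le_supNorm b l
      rw [Finset.mem_Icc]
      omega
  refine (Finset.card_le_card hsub).trans (Finset.card_biUnion_le.trans ?_)
  refine (Finset.sum_le_card_nsmul _ _ (2 * ((3 * x) * (3 * y) ^ (d - 2))) fun j hj => ?_).trans ?_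
  · have hjp : j ≠ p := Finset.ne_of_mem_erase hj
    rw [hF, Fintype.card_piFinset]
    refine prod_le_mul_mul_pow _ hjp ?_ ?_ fun l hl hl' => ?_
    · simpa using Finset.card_le_two
    · simp only [hjp.symm, if_false, if_true, Int.card_Icc]
      omega
    · simp only [hl, hl', if_false, Int.card_Icc]
      omega
  · rw [smul_eq_mul]
    gcongr
    simp

/-- Pairs of vectors `b ∈ B`, `c ∈ ℤ^m` for which the sup norm of `c` times `w b` is at
most `N`. -/
noncomputable def weightedPairs {d : ℕ} (B : Finset (Fin d → ℤ)) (w : (Fin d → ℤ) → ℕ) (N m : ℕ) :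
    Finset ((_ : Fin d → ℤ) × (Fin m → ℤ)) :=
  B.sigma fun b => intBox m (N / w b)

theorem mem_weightedPairs {d : ℕ} {B : Finset (Fin d → ℤ)} {w : (Fin d → ℤ) → ℕ} {N m : ℕ}
    {x : (_ : Fin d → ℤ) × (Fin m → ℤ)} (hw : 1 ≤ w x.1) :
    x ∈ weightedPairs B w N m ↔ x.1 ∈ B ∧ ∀ j, (x.2 j).natAbs * w x.1 ≤ N := by
  rw [weightedPairs, Finset.mem_sigma, mem_intBox, supNorm_le_iff]
  simp only [Nat.le_div_iff_mul_le hw]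

/-- Sort by `y = w b`. Since `y ≤ N`, there are at most `2 * (N / y) + 1 ≤ 3 * N / y` values for
each entry of `c`. -/
theorem card_weightedPairs_le {d : ℕ} (B : Finset (Fin d → ℤ)) (w : (Fin d → ℤ) → ℕ)
    (N m x : ℕ) (S : ℕ → ℝ) (hx : 1 ≤ x) (hw : ∀ b ∈ B, w b ∈ Finset.Icc x N)
    (hS : ∀ y ∈ Finset.Icc x N, ((B.filter fun b => w b = y).card : ℝ) ≤ S y) :
    ((weightedPairs B w N m).card : ℝ) ≤
      (3 * N) ^ m * ∑ y ∈ Finset.Icc x N, S y / (y : ℝ) ^ m := by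
  rw [weightedPairs, Finset.card_sigma, ← Finset.sum_fiberwise_of_maps_to hw, Nat.cast_sum,
    Finset.mul_sum]
  refine Finset.sum_le_sum fun y hy => ?_
  have hy' := Finset.mem_Icc.mp hy
  have hy0 : (0 : ℝ) < y := by exact_mod_cast (by omega : 0 < y)
  have hterm : ∀ b ∈ B.filter fun b => w b = y,
      ((intBox m (N / w b)).card : ℝ) ≤ (3 * N / y : ℝ) ^ m := by
    intro b hb
    rw [(Finset.mem_filter.mp hb).2, card_intBox]
    push_cast
    gcongr
    have h1 : ((N / y : ℕ) : ℝ) ≤ (N : ℝ) / y := Nat.cast_div_le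
    have h2 : (1 : ℝ) ≤ N / y := by
      rw [le_div_iff₀ hy0, one_mul]
      exact_mod_cast hy'.2
    rw [mul_div_assoc]
    linarith
  rw [Nat.cast_sum]
  refine (Finset.sum_le_card_nsmul _ _ _ hterm).trans ?_
  rw [nsmul_eq_mul, div_pow]
  have := hS y hy
  calc _ ≤ S y * ((3 * N : ℝ) ^ m / (y : ℝ) ^ m) := by gcongr
    _ = _ := by ring

/-- Nonzero integer vectors of sup norm at most `N`. -/
noncomputable def puncturedBox (d N : ℕ) : Finset (Fin d → ℤ) := (intBox d N).filter fun b => 1 ≤ supNorm b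

theorem mem_puncturedBox {d N : ℕ} {b : Fin d → ℤ} :
    b ∈ puncturedBox d N ↔ supNorm b ≤ N ∧ 1 ≤ supNorm b := by
  rw [puncturedBox, Finset.mem_filter, mem_intBox]

theorem card_pairs_le (d m N : ℕ) :
    ((weightedPairs (puncturedBox d N) supNorm N m).card : ℝ) ≤
      (2 * d * 3 ^ (d - 1) * 3 ^ m) * N ^ m *
        ∑ y ∈ Finset.Icc 1 N, (y : ℝ) ^ (d - 1) / (y : ℝ) ^ m := by
  refine (card_weightedPairs_le _ _ N m 1 (fun y => d * (2 * (3 * y) ^ (d - 1))) le_rfl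
    (fun b hb => ?_) fun y hy => ?_).trans (le_of_eq ?_)
  · have := mem_puncturedBox.mp hb
    rw [Finset.mem_Icc]; omega
  · have h := card_sphere_le d N y (Finset.mem_Icc.mp hy).1
    have h2 : ((puncturedBox d N).filter fun b => supNorm b = y).card ≤
        ((intBox d N).filter fun b => supNorm b = y).card :=
      Finset.card_le_card (Finset.filter_subset_filter _ (Finset.filter_subset _ _))
    exact_mod_cast h2.trans h
  · rw [Finset.mul_sum, Finset.mul_sum]
    refine Finset.sum_congr rfl fun y _ => ?_
    rw [mul_pow, mul_pow]
    ring

/-- Telescoping, by `1 / (M + 1) ^ 2 ≤ 1 / M - 1 / (M + 1)`. -/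
theorem sum_one_div_sq_le (x N : ℕ) (hx : 1 ≤ x) :
    ∑ y ∈ Finset.Ioc x N, (1 : ℝ) / (y : ℝ) ^ 2 ≤ 1 / x := by
  rcases le_total N x with h | h
  · rw [Finset.Ioc_eq_empty_of_le h]
    simp
  have key : ∑ y ∈ Finset.Ioc x N, (1 : ℝ) / (y : ℝ) ^ 2 ≤ 1 / x - 1 / N := by
    induction N, h using Nat.le_induction with
    | base => simp
    | succ M hM ih =>
      rw [← Finset.sum_Ioc_consecutive _ hM (Nat.le_succ M)]
      have hM0 : (0 : ℝ) < M := by exact_mod_cast (by omega : 0 < M)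
      have : (1 : ℝ) / ((M + 1 : ℕ) : ℝ) ^ 2 ≤ 1 / M - 1 / ((M + 1 : ℕ) : ℝ) := by
        push_cast
        rw [div_sub_div _ _ hM0.ne' (by positivity), div_le_div_iff₀ (by positivity)
          (by positivity)]
        nlinarith
      simp only [Nat.Ioc_succ_singleton, Finset.sum_singleton]
      linarith
  have h0 : (0 : ℝ) ≤ 1 / (N : ℝ) := by positivity
  linarith

/-- The number of pairs `(b, c)` of integer vectors with product of the norms at most `N`. -/
theorem card_pairs_le_of_ne (d m : ℕ) (hd : 1 ≤ d) (hmd : m ≠ d) : ∃ C : ℝ, 0 ≤ C ∧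
    ∀ N : ℕ, 1 ≤ N →
      ((weightedPairs (puncturedBox d N) supNorm N m).card : ℝ) ≤ C * (N : ℝ) ^ max m d := by
  refine ⟨2 * d * 3 ^ (d - 1) * 3 ^ m * 2, by positivity, fun N hN => ?_⟩
  refine (card_pairs_le d m N).trans ?_
  have hN1 : (1 : ℝ) ≤ N := by exact_mod_cast hN
  have key : (N : ℝ) ^ m * ∑ y ∈ Finset.Icc 1 N, (y : ℝ) ^ (d - 1) / (y : ℝ) ^ m ≤
      2 * (N : ℝ) ^ max m d := by
    rcases lt_or_gt_of_ne hmd with h | h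
    · rw [max_eq_right h.le]
      have h1 : ∀ y ∈ Finset.Icc 1 N,
          (y : ℝ) ^ (d - 1) / (y : ℝ) ^ m ≤ (N : ℝ) ^ (d - 1 - m) := by
        intro y hy
        have hy' := Finset.mem_Icc.mp hy
        have hy0 : (y : ℝ) ≠ 0 := by
          have : y ≠ 0 := by omega
          exact_mod_cast this
        rw [div_eq_mul_inv, ← pow_sub₀ _ hy0 (by omega)]
        gcongr
        exact hy'.2
      have h2 := Finset.sum_le_card_nsmul _ _ _ h1
      rw [Nat.card_Icc, nsmul_eq_mul, Nat.add_sub_cancel] at h2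
      calc _ ≤ (N : ℝ) ^ m * (N * (N : ℝ) ^ (d - 1 - m)) := by gcongr
        _ = (N : ℝ) ^ (m + 1 + (d - 1 - m)) := by ring
        _ = (N : ℝ) ^ d := by congr 1; omega
        _ ≤ _ := by
          have : (0 : ℝ) ≤ (N : ℝ) ^ d := by positivity
          linarith
    · rw [max_eq_left h.le]
      -- For `m > d` the exponent `d - 1 - m` is at most `-2`, so the sum converges and is at most
      -- 2.
      have h1 : ∀ y ∈ Finset.Icc 1 N,
          (y : ℝ) ^ (d - 1) / (y : ℝ) ^ m ≤ 1 / (y : ℝ) ^ 2 := by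
        intro y hy
        have hy' := Finset.mem_Icc.mp hy
        have hy1 : (1 : ℝ) ≤ y := by exact_mod_cast hy'.1
        rw [div_le_div_iff₀ (by positivity) (by positivity), one_mul, ← pow_add]
        exact pow_le_pow_right₀ hy1 (by omega)
      have h2 := Finset.sum_le_sum h1
      have h3 := sum_one_div_sq_le 1 N le_rfl
      rw [← Finset.add_sum_Ioc_eq_sum_Icc hN] at h2
      rw [mul_comm]
      gcongr
      rw [← Finset.add_sum_Ioc_eq_sum_Icc hN] at h2 ⊢
      norm_num at h2 h3 ⊢
      linarith
  calc _ = 2 * d * 3 ^ (d - 1) * 3 ^ m * ((N : ℝ) ^ m *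
        ∑ y ∈ Finset.Icc 1 N, (y : ℝ) ^ (d - 1) / (y : ℝ) ^ m) := by ring
    _ ≤ 2 * d * 3 ^ (d - 1) * 3 ^ m * (2 * (N : ℝ) ^ max m d) := by gcongr
    _ = _ := by ring

/-- With `m = d` the summand is `1 / y`, and the harmonic sum is the source of the logarithm. -/
theorem card_pairs_le_of_eq (d : ℕ) (hd : 1 ≤ d) : ∃ C : ℝ, 0 ≤ C ∧
    ∀ N : ℕ, 1 ≤ N →
      ((weightedPairs (puncturedBox d N) supNorm N d).card : ℝ) ≤
        C * ((N : ℝ) ^ d * (1 + Real.log N)) := by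
  refine ⟨2 * d * 3 ^ (d - 1) * 3 ^ d, by positivity, fun N hN => ?_⟩
  refine (card_pairs_le d d N).trans ?_
  rw [mul_assoc]
  gcongr
  refine le_trans (le_of_eq ?_) (harmonic_le_one_add_log N)
  rw [harmonic_eq_sum_Icc]
  push_cast
  refine Finset.sum_congr rfl fun y hy => ?_
  have hy0 : (y : ℝ) ≠ 0 := by
    have : y ≠ 0 := by have := Finset.mem_Icc.mp hy; omega
    exact_mod_cast this
  obtain ⟨e, rfl⟩ : ∃ e, d = e + 1 := ⟨d - 1, by omega⟩
  rw [Nat.add_sub_cancel, pow_succ]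
  field_simp

/-- For a fixed slab of width `x`, the number of pairs of vectors `(b, c)` with `b` in the slab
has no logarithmic factor. -/
theorem card_slab_pairs_le (d : ℕ) (hd : 2 ≤ d) : ∃ C : ℝ, 0 ≤ C ∧
    ∀ (N x : ℕ) (p : Fin d), 1 ≤ x → x ≤ N →
      ((weightedPairs ((intBox d N).filter fun b => (b p).natAbs ≤ x)
        (fun b => max (supNorm b) x) N d).card : ℝ) ≤ C * (N : ℝ) ^ d := by
  refine ⟨3 ^ d * (3 ^ d + 2 * d * 3 ^ (d - 1)), by positivity, fun N x p hx hxN => ?_⟩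
  have hx0 : (0 : ℝ) < x := by exact_mod_cast hx
  -- The weight `max (supNorm b) x` takes the value `x` on the whole box of radius `x`, hence the
  -- separate term at `y = x`.
  refine (card_weightedPairs_le _ _ N d x (fun y => if y = x then (3 * x : ℝ) ^ d else
    d * (2 * ((3 * x) * (3 * y) ^ (d - 2)))) hx (fun b hb => ?_) fun y hy => ?_).trans ?_
  · have := mem_intBox.mp (Finset.mem_filter.mp hb).1
    rw [Finset.mem_Icc]; omega
  · rw [Finset.filter_filter]
    split_ifs with h
    · have h1 : ((intBox d N).filter fun b => (b p).natAbs ≤ x ∧ max (supNorm b) x = y) ⊆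
          intBox d x := by
        intro b hb
        have := (Finset.mem_filter.mp hb).2.2
        rw [mem_intBox]; omega
      have h2 := Finset.card_le_card h1
      rw [card_intBox] at h2
      have h3 : (2 * x + 1) ^ d ≤ (3 * x) ^ d := Nat.pow_le_pow_left (by omega) d
      exact_mod_cast h2.trans h3
    · have hxy : x < y := lt_of_le_of_ne (Finset.mem_Icc.mp hy).1 (Ne.symm h)
      have h1 : ((intBox d N).filter fun b => (b p).natAbs ≤ x ∧ max (supNorm b) x = y) ⊆
          (intBox d N).filter fun b => (b p).natAbs ≤ x ∧ supNorm b = y := by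
        intro b hb
        rw [Finset.mem_filter] at hb ⊢
        refine ⟨hb.1, hb.2.1, ?_⟩
        have := hb.2.2
        omega
      exact_mod_cast (Finset.card_le_card h1).trans (card_sphere_slab_le d N x y p hx hxy)
  · rw [← Finset.add_sum_Ioc_eq_sum_Icc hxN]
    -- The slab turns `1 / y` into `x / y ^ 2`, and the tail sum `1 / x` cancels the factor `x`.
    have h1 : ∀ y ∈ Finset.Ioc x N, (if y = x then (3 * x : ℝ) ^ d else
        d * (2 * ((3 * x) * (3 * y) ^ (d - 2)))) / (y : ℝ) ^ d =
          (2 * d * 3 ^ (d - 1) * x) * (1 / (y : ℝ) ^ 2) := by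
      intro y hy
      have hxy := (Finset.mem_Ioc.mp hy).1
      have hy0 : (y : ℝ) ≠ 0 := by
        have : y ≠ 0 := by omega
        exact_mod_cast this
      rw [if_neg hxy.ne']
      obtain ⟨e, rfl⟩ : ∃ e, d = e + 2 := ⟨d - 2, by omega⟩
      rw [Nat.add_sub_cancel, show e + 2 - 1 = e + 1 by omega, mul_pow]
      field_simp
      ring
    rw [Finset.sum_congr rfl h1, ← Finset.mul_sum, if_pos rfl, mul_pow, mul_pow,
      mul_div_assoc, div_self (by positivity), mul_one]
    have h2 := sum_one_div_sq_le x N hx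
    calc _ ≤ (3 : ℝ) ^ d * (N : ℝ) ^ d * (3 ^ d + 2 * d * 3 ^ (d - 1) * x * (1 / x)) := by gcongr
      _ = _ := by field_simp

/-! ### Upper bounds -/

theorem card_latticeCube (n d : ℕ) : (latticeCube n d).card = n ^ d := by
  simp [latticeCube]

theorem mem_affineTuples {n d k r : ℕ} {p : Fin r → Fin d → ℤ} :
    p ∈ affineTuples n d k r ↔ (∀ i, p i ∈ latticeCube n d) ∧ LiesInAffine k p := by
  classical
  rw [affineTuples, Finset.mem_filter, Fintype.mem_piFinset]

/-- The first point and any decomposition of the differences recover the tuple, so decompositions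
need not be unique. -/
theorem card_affineTuples_le_mul {n d k m : ℕ}
    (T : Finset (Fin k → (_ : Fin d → ℤ) × (Fin m → ℤ)))
    (hT : ∀ p ∈ affineTuples n d k (m + 1), ∃ x ∈ T,
      ∀ j l, p j.succ l - p 0 l = ∑ i, (x i).2 j * (x i).1 l) :
    (affineTuples n d k (m + 1)).card ≤ n ^ d * T.card := by
  classical
  have hsub : affineTuples n d k (m + 1) ⊆ (latticeCube n d ×ˢ T).image fun y =>
      (Fin.cons y.1 fun j l => y.1 l + ∑ i, (y.2 i).2 j * (y.2 i).1 l :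
        Fin (m + 1) → Fin d → ℤ) := by
    intro p hp
    obtain ⟨x, hx, hpx⟩ := hT p hp
    refine Finset.mem_image.mpr ⟨(p 0, x), Finset.mem_product.mpr
      ⟨(mem_affineTuples.mp hp).1 0, hx⟩, ?_⟩
    funext i
    refine Fin.cases ?_ (fun j => ?_) i
    · simp
    · funext l
      simp only [Fin.cons_succ]
      rw [← hpx]; ring
  refine (Finset.card_le_card hsub).trans (Finset.card_image_le.trans ?_)
  rw [Finset.card_product, card_latticeCube]

theorem card_affineTuples_le_of_ne (d k m : ℕ) (hd : 1 ≤ d) (hmd : m ≠ d) : ∃ C : ℝ, 0 ≤ C ∧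
    ∀ n : ℕ, 1 ≤ n →
      ((affineTuples n d k (m + 1)).card : ℝ) ≤ C * (n : ℝ) ^ (d + k * max m d) := by
  obtain ⟨K, hK, hdec⟩ := exists_decomposition d k hd
  obtain ⟨C, hC, hpairs⟩ := card_pairs_le_of_ne d m hd hmd
  refine ⟨(C * (K : ℝ) ^ max m d) ^ k, by positivity, fun n hn => ?_⟩
  have h1 := card_affineTuples_le_mul (n := n) (d := d) (k := k) (m := m)
    (Fintype.piFinset fun _ => weightedPairs (puncturedBox d (K * n)) supNorm (K * n) m) (by
      intro p hp
      obtain ⟨hp1, hp2⟩ := mem_affineTuples.mp hp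
      obtain ⟨b, c, hbc, hb, hc⟩ := hdec n m hn p hp1 hp2
      refine ⟨fun i => ⟨b i, c i⟩, Fintype.mem_piFinset.mpr fun i => ?_, hbc⟩
      rw [mem_weightedPairs (hb i).1]
      exact ⟨mem_puncturedBox.mpr (hb i).symm, hc i⟩)
  rw [Fintype.card_piFinset, Finset.prod_const, Finset.card_univ, Fintype.card_fin] at h1
  have h2 := hpairs (K * n) (by nlinarith)
  calc ((affineTuples n d k (m + 1)).card : ℝ) ≤ (n : ℝ) ^ d *
        ((weightedPairs (puncturedBox d (K * n)) supNorm (K * n) m).card : ℝ) ^ k := by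
        exact_mod_cast h1
    _ ≤ (n : ℝ) ^ d * (C * ((K * n : ℕ) : ℝ) ^ max m d) ^ k := by gcongr
    _ = _ := by
      push_cast
      rw [mul_pow (K : ℝ), ← mul_assoc, mul_pow (C * _), ← pow_mul, mul_comm (max m d) k, pow_add]
      ring

/-- A decomposition into matrices of rank at most one can be reduced modulo its smallest row. -/
theorem exists_reduced_decomposition {d k m N : ℕ} (b : Fin (k + 1) → Fin d → ℤ)
    (c : Fin (k + 1) → Fin m → ℤ) (hb : ∀ i, 1 ≤ supNorm (b i) ∧ supNorm (b i) ≤ N)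
    (hc : ∀ i j, (c i j).natAbs * supNorm (b i) ≤ N) (pivot : (Fin d → ℤ) → Fin d)
    (hpivot : ∀ b, 1 ≤ supNorm b → (b (pivot b)).natAbs = supNorm b) :
    ∃ (b' : Fin (k + 1) → Fin d → ℤ) (c' : Fin (k + 1) → Fin m → ℤ),
      (∀ j l, ∑ i, c' i j * b' i l = ∑ i, c i j * b i l) ∧
      (1 ≤ supNorm (b' 0) ∧ supNorm (b' 0) ≤ (2 * k + 3) * N) ∧
      (∀ j, (c' 0 j).natAbs * supNorm (b' 0) ≤ (2 * k + 3) * N) ∧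
      ∀ i : Fin k, supNorm (b' i.succ) ≤ (2 * k + 3) * N ∧
        (b' i.succ (pivot (b' 0))).natAbs ≤ supNorm (b' 0) ∧
        ∀ j, (c' i.succ j).natAbs * max (supNorm (b' i.succ)) (supNorm (b' 0)) ≤
          (2 * k + 3) * N := by
  -- Swap a shortest vector into position 0.
  wlog hmin : ∀ i, supNorm (b 0) ≤ supNorm (b i) generalizing b c
  · obtain ⟨i0, hi0⟩ := Finite.exists_min fun i => supNorm (b i)
    obtain ⟨b', c', h1, h2⟩ := this (fun i => b (Equiv.swap 0 i0 i)) (fun i => c (Equiv.swap 0 i0 i))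
      (fun i => hb _) (fun i => hc _) (fun i => by simpa using hi0 _)
    refine ⟨b', c', fun j l => (h1 j l).trans ?_, h2⟩
    exact Equiv.sum_comp (Equiv.swap 0 i0) fun i => c i j * b i l
  set x := supNorm (b 0) with hx
  set q := pivot (b 0) with hq
  have hbq : (b 0 q).natAbs = x := hpivot _ (hb 0).1
  have hx1 : 1 ≤ x := (hb 0).1
  have hbq0 : b 0 q ≠ 0 := by omega
  -- Replacing `b i.succ` by `b i.succ - t i * b 0` is compensated by adding `∑ t i * c i.succ` to
  -- `c 0`.
  set t : Fin k → ℤ := fun i => b i.succ q / b 0 q with ht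
  have hrem : ∀ i : Fin k, (b i.succ q - t i * b 0 q).natAbs ≤ x := by
    intro i
    have h1 : b i.succ q - t i * b 0 q = b i.succ q % b 0 q := by
      rw [Int.emod_def]; ring
    rw [h1]
    have h2 := Int.emod_nonneg (b i.succ q) hbq0
    have h3 := Int.emod_lt_abs (b i.succ q) hbq0
    rw [← Int.natCast_natAbs, hbq] at h3
    omega
  -- The product `t i * b 0 q` differs from `b i.succ q` by at most `x`, and `x ≤ supNorm (b
  -- i.succ)`. The new vectors thus grow by a factor of at most 3 and the new `c 0` costs `(2 * k +
  -- 1) * N`; `2 * k + 3` covers both.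
  have ht2 : ∀ i : Fin k, (t i).natAbs * x ≤ 2 * supNorm (b i.succ) := by
    intro i
    rw [← hbq, ← Int.natAbs_mul]
    have h1 := hrem i
    have h2 := natAbs_le_supNorm (b i.succ) q
    have h3 := hmin i.succ
    omega
  have hnew : ∀ i : Fin k, supNorm (fun l => b i.succ l - t i * b 0 l) ≤ 3 * supNorm (b i.succ) := by
    intro i
    rw [supNorm_le_iff]
    intro l
    have h1 : (t i * b 0 l).natAbs ≤ (t i).natAbs * x := by
      rw [Int.natAbs_mul]
      gcongr
      exact natAbs_le_supNorm _ _
    have h2 := ht2 i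
    have h3 := natAbs_le_supNorm (b i.succ) l
    omega
  refine ⟨Fin.cons (b 0) fun i l => b i.succ l - t i * b 0 l,
    Fin.cons (fun j => c 0 j + ∑ i : Fin k, t i * c i.succ j) fun i => c i.succ, ?_, ?_, ?_, ?_⟩
  · intro j l
    rw [Fin.sum_univ_succ, Fin.sum_univ_succ]
    simp only [Fin.cons_zero, Fin.cons_succ]
    rw [add_mul, Finset.sum_mul, add_assoc, ← Finset.sum_add_distrib]
    congr 1
    exact Finset.sum_congr rfl fun i _ => by ring
  · simp only [Fin.cons_zero]
    have := hb 0
    exact ⟨this.1, this.2.trans (Nat.le_mul_of_pos_left N (by omega))⟩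
  · intro j
    simp only [Fin.cons_zero]
    have h1 : (∑ i : Fin k, t i * c i.succ j).natAbs * x ≤ k * (2 * N) := by
      calc _ ≤ (∑ i : Fin k, (t i * c i.succ j).natAbs) * x := by
            gcongr
            exact Int.natAbs_sum_le _ _
        _ = ∑ i : Fin k, (t i * c i.succ j).natAbs * x := Finset.sum_mul _ _ _
        _ ≤ ∑ i : Fin k, 2 * N := by
          refine Finset.sum_le_sum fun i _ => ?_
          rw [Int.natAbs_mul]
          calc _ = ((t i).natAbs * x) * (c i.succ j).natAbs := by ring
            _ ≤ (2 * supNorm (b i.succ)) * (c i.succ j).natAbs :=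
              Nat.mul_le_mul_right _ (ht2 i)
            _ = 2 * ((c i.succ j).natAbs * supNorm (b i.succ)) := by ring
            _ ≤ 2 * N := by gcongr; exact hc _ _
        _ = _ := by simp
    have h2 := hc 0 j
    calc _ ≤ ((c 0 j).natAbs + (∑ i : Fin k, t i * c i.succ j).natAbs) * x := by
          gcongr
          exact Int.natAbs_add_le _ _
      _ ≤ N + k * (2 * N) := by
        rw [add_mul]
        exact add_le_add h2 h1
      _ ≤ _ := by nlinarith
  · intro i
    simp only [Fin.cons_zero, Fin.cons_succ]
    refine ⟨?_, hrem i, fun j => ?_⟩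
    · have := hb i.succ
      refine (hnew i).trans ?_
      nlinarith
    · have h1 : max (supNorm fun l => b i.succ l - t i * b 0 l) (supNorm (b 0)) ≤
          3 * supNorm (b i.succ) := by
        have := hmin i.succ
        exact max_le (hnew i) (by omega)
      calc _ ≤ (c i.succ j).natAbs * (3 * supNorm (b i.succ)) := by gcongr
        _ = 3 * ((c i.succ j).natAbs * supNorm (b i.succ)) := by ring
        _ ≤ 3 * N := by gcongr; exact hc _ _
        _ ≤ _ := by nlinarith

/-- The pair of index 0 is counted with a logarithm. It fixes the slab that holds the other `k`
vectors, and their pairs are counted without one. -/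
theorem card_affineTuples_le_of_eq (d k : ℕ) (hd : 2 ≤ d) : ∃ C : ℝ, 0 ≤ C ∧
    ∀ n : ℕ, 3 ≤ n → ((affineTuples n d (k + 1) (d + 1)).card : ℝ) ≤
      C * ((n : ℝ) ^ (d * (k + 1 + 1)) * Real.log n) := by
  obtain ⟨K, hK, hdec⟩ := exists_decomposition d (k + 1) (by omega)
  obtain ⟨C₁, hC₁, hpairs⟩ := card_pairs_le_of_eq d (by omega)
  obtain ⟨C₂, hC₂, hslab⟩ := card_slab_pairs_le d hd
  have hpivot : ∀ b : Fin d → ℤ, ∃ i, 1 ≤ supNorm b → (b i).natAbs = supNorm b := by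
    intro b
    by_cases h : 1 ≤ supNorm b
    · obtain ⟨i, hi⟩ := exists_natAbs_eq_supNorm b h
      exact ⟨i, fun _ => hi⟩
    · exact ⟨⟨0, by omega⟩, fun h' => absurd h' h⟩
  choose pivot hpivot using hpivot
  set M := (2 * k + 3) * K with hM
  have hM1 : 1 ≤ M := by nlinarith
  have hlogM : 0 ≤ Real.log M := Real.log_natCast_nonneg M
  refine ⟨C₁ * M ^ d * (C₂ * M ^ d) ^ k * (2 + Real.log M), by positivity, fun n hn => ?_⟩
  classical
  have h1 := card_affineTuples_le_mul (n := n) (d := d) (k := k + 1) (m := d)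
    (((weightedPairs (puncturedBox d (M * n)) supNorm (M * n) d).sigma fun x =>
      Fintype.piFinset fun _ : Fin k => weightedPairs ((intBox d (M * n)).filter fun b =>
        (b (pivot x.1)).natAbs ≤ supNorm x.1) (fun b => max (supNorm b) (supNorm x.1))
          (M * n) d).image fun y => Fin.cons y.1 y.2) (by
      intro p hp
      obtain ⟨hp1, hp2⟩ := mem_affineTuples.mp hp
      obtain ⟨b, c, hbc, hb, hc⟩ := hdec n d (by omega) p hp1 hp2
      obtain ⟨b', c', hbc', hb0, hc0, hsucc⟩ :=
        exists_reduced_decomposition b c hb hc pivot hpivot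
      rw [← mul_assoc, ← hM] at hb0
      simp only [← mul_assoc, ← hM] at hc0 hsucc
      refine ⟨fun i => ⟨b' i, c' i⟩, Finset.mem_image.mpr ⟨⟨⟨b' 0, c' 0⟩,
        fun i => ⟨b' i.succ, c' i.succ⟩⟩, Finset.mem_sigma.mpr ⟨?_, ?_⟩, ?_⟩, ?_⟩
      · rw [mem_weightedPairs hb0.1]
        exact ⟨mem_puncturedBox.mpr hb0.symm, hc0⟩
      · refine Fintype.mem_piFinset.mpr fun i => ?_
        rw [mem_weightedPairs (le_max_of_le_right hb0.1)]
        obtain ⟨h1, h2, h3⟩ := hsucc i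
        exact ⟨Finset.mem_filter.mpr ⟨mem_intBox.mpr h1, h2⟩, h3⟩
      · funext i
        refine Fin.cases ?_ (fun j => ?_) i <;> simp
      · intro j l
        rw [hbc, hbc'])
  have hn0 : (0 : ℝ) < n := by exact_mod_cast (by omega : 0 < n)
  have hlog : 1 ≤ Real.log n := by
    rw [Real.le_log_iff_exp_le hn0]
    have : (3 : ℝ) ≤ n := by exact_mod_cast hn
    linarith [Real.exp_one_lt_d9]
  have hMn : 1 ≤ M * n := by nlinarith
  have h2 := hpairs (M * n) hMn
  -- Uses `1 ≤ log n`, which is why `3 ≤ n` is assumed.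
  have h3 : 1 + Real.log ((M * n : ℕ) : ℝ) ≤ (2 + Real.log M) * Real.log n := by
    rw [Nat.cast_mul, Real.log_mul (by positivity) hn0.ne']
    nlinarith
  have h4 : (((weightedPairs (puncturedBox d (M * n)) supNorm (M * n) d).sigma fun x =>
      Fintype.piFinset fun _ : Fin k => weightedPairs ((intBox d (M * n)).filter fun b =>
        (b (pivot x.1)).natAbs ≤ supNorm x.1) (fun b => max (supNorm b) (supNorm x.1))
          (M * n) d).card : ℝ) ≤
      (weightedPairs (puncturedBox d (M * n)) supNorm (M * n) d).card *
        (C₂ * ((M * n : ℕ) : ℝ) ^ d) ^ k := by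
    rw [Finset.card_sigma, Nat.cast_sum, ← nsmul_eq_mul]
    refine Finset.sum_le_card_nsmul _ _ _ fun x hx => ?_
    rw [Fintype.card_piFinset, Finset.prod_const, Finset.card_univ, Fintype.card_fin, Nat.cast_pow]
    have hx1 := mem_puncturedBox.mp (Finset.mem_sigma.mp hx).1
    have := hslab (M * n) (supNorm x.1) (pivot x.1) hx1.2 hx1.1
    gcongr
  calc ((affineTuples n d (k + 1) (d + 1)).card : ℝ) ≤ (n : ℝ) ^ d * (
        (weightedPairs (puncturedBox d (M * n)) supNorm (M * n) d).card *
        (C₂ * ((M * n : ℕ) : ℝ) ^ d) ^ k) := by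
        refine le_trans (Nat.cast_le.mpr (h1.trans (Nat.mul_le_mul_left _ Finset.card_image_le))) ?_
        rw [Nat.cast_mul, Nat.cast_pow]
        gcongr
    _ ≤ (n : ℝ) ^ d * (C₁ * (((M * n : ℕ) : ℝ) ^ d * ((2 + Real.log M) * Real.log n)) *
        (C₂ * ((M * n : ℕ) : ℝ) ^ d) ^ k) := by
        gcongr
        exact h2.trans (by gcongr)
    _ = _ := by
      push_cast
      rw [mul_pow (M : ℝ), ← mul_assoc C₂, mul_pow (C₂ * _), ← pow_mul,
        show d * (k + 1 + 1) = d + d + d * k by ring, pow_add, pow_add]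
      ring

/-! ### Lower bounds without logarithm -/

theorem exists_submodule_ge_finrank_eq {V : Type*} [AddCommGroup V] [Module ℝ V]
    [FiniteDimensional ℝ V] (U : Submodule ℝ V) {k : ℕ} (hUk : Module.finrank ℝ U ≤ k)
    (hk : k ≤ Module.finrank ℝ V) : ∃ W, U ≤ W ∧ Module.finrank ℝ W = k := by
  induction k, hUk using Nat.le_induction with
  | base => exact ⟨U, le_rfl, rfl⟩
  | succ j hj ih =>
    obtain ⟨W, hUW, hW⟩ := ih (by omega)
    have hne : W ≠ ⊤ := by
      rintro rfl
      rw [finrank_top] at hW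
      omega
    obtain ⟨x, -, hx⟩ := SetLike.exists_of_lt (lt_top_iff_ne_top.mpr hne)
    refine ⟨W ⊔ Submodule.span ℝ {x}, hUW.trans le_sup_left, le_antisymm ?_ ?_⟩
    · refine (Submodule.finrank_add_le_finrank_add_finrank _ _).trans ?_
      rw [hW]
      gcongr
      exact (finrank_span_le_card {x}).trans (by simp)
    · rw [← hW]
      refine Nat.succ_le_of_lt (Submodule.finrank_lt_finrank_of_lt ?_)
      refine lt_of_le_of_ne le_sup_left fun h => hx ?_
      rw [h]
      exact Submodule.mem_sup_right (Submodule.mem_span_singleton_self x)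

/-- The vectors `a j` may be dependent; their span is enlarged to dimension exactly `k`. -/
theorem liesInAffine_of_combination {d r k : ℕ} (hk : k ≤ d) (p : Fin r → Fin d → ℤ)
    (x : Fin d → ℝ) (a : Fin k → Fin d → ℝ)
    (h : ∀ i, ∃ c : Fin k → ℝ, ∀ l, (p i l : ℝ) = x l + ∑ j, c j * a j l) :
    LiesInAffine k p := by
  obtain ⟨W, hW, hWk⟩ := exists_submodule_ge_finrank_eq (Submodule.span ℝ (Set.range a))
    (k := k) ((finrank_range_le_card a).trans (by simp)) (by simpa using hk)
  refine ⟨AffineSubspace.mk' x W, AffineSubspace.mk'_nonempty x W, by rw [AffineSubspace.direction_mk', hWk], fun i => ?_⟩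
  obtain ⟨c, hc⟩ := h i
  rw [AffineSubspace.mem_mk', vsub_eq_sub]
  have h1 : (fun l => (p i l : ℝ)) - x = ∑ j, c j • a j := by
    funext l
    simp [hc l, Finset.sum_apply]
  rw [h1]
  exact W.sum_mem fun j _ => W.smul_mem _ (hW (Submodule.subset_span ⟨j, rfl⟩))

theorem mem_affineInjTuples {n d k r : ℕ} {p : Fin r → Fin d → ℤ} :
    p ∈ affineInjTuples n d k r ↔
      ((∀ i, p i ∈ latticeCube n d) ∧ LiesInAffine k p) ∧ Function.Injective p := by
  classical
  rw [affineInjTuples, Finset.mem_filter, mem_affineTuples]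

theorem mem_latticeCube {n d : ℕ} {x : Fin d → ℤ} :
    x ∈ latticeCube n d ↔ ∀ l, 1 ≤ x l ∧ x l ≤ n := by
  simp [latticeCube]

/-- Integer division loses at most a factor of two. -/
theorem div_two_mul_le_natDiv {n q : ℕ} (hq : 1 ≤ q) (hqn : q ≤ n) :
    (n : ℝ) / (2 * q) ≤ ((n / q : ℕ) : ℝ) := by
  have h1 : n < 2 * q * (n / q) := by
    have h2 := Nat.lt_mul_div_succ n hq
    have h3 : 1 ≤ n / q := (Nat.one_le_div_iff hq).mpr hqn
    nlinarith
  have hq0 : (0 : ℝ) < q := by exact_mod_cast hq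
  rw [div_le_iff₀ (by positivity)]
  have h4 : (n : ℝ) < 2 * q * ((n / q : ℕ) : ℝ) := by exact_mod_cast h1
  linarith

/-- Tuples in translates of a coordinate subspace. -/
theorem le_card_affineInjTuples_parallel (k e r N n : ℕ) (hk : 1 ≤ k) (hr : 1 ≤ r)
    (hN : r * N ≤ n) : N ^ (e + k * r) ≤ (affineInjTuples n (k + e) k r).card := by
  have hcard : (latticeCube N e ×ˢ Fintype.piFinset fun _ : Fin r => latticeCube N k).card =
      N ^ (e + k * r) := by
    rw [Finset.card_product, Fintype.card_piFinset, Finset.prod_const, card_latticeCube,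
      card_latticeCube, Finset.card_univ, Fintype.card_fin, ← pow_mul, pow_add]
  rw [← hcard]
  refine Finset.card_le_card_of_injOn
    -- The shift by `i * N` puts the points into disjoint blocks, so they are distinct; this needs
    -- `r * N ≤ n`.
    (fun y i => Fin.append (fun l => y.2 i l + (i : ℕ) * N) y.1) (fun y hy => ?_) ?_
  · obtain ⟨h1, h2⟩ := Finset.mem_product.mp hy
    rw [Fintype.mem_piFinset] at h2
    simp only [mem_latticeCube] at h1 h2
    refine mem_affineInjTuples.mpr ⟨⟨fun i => mem_latticeCube.mpr fun l => ?_, ?_⟩, ?_⟩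
    · refine Fin.addCases (fun l => ?_) (fun l => ?_) l
      · simp only [Fin.append_left]
        have h3 := h2 i l
        have h4 : ((i : ℕ) + 1) * N ≤ n := le_trans (by gcongr; omega) hN
        zify at h4
        constructor <;> nlinarith
      · simp only [Fin.append_right]
        have h3 := h1 l
        have h4 : N ≤ n := le_trans (by nlinarith) hN
        omega
    · refine liesInAffine_of_combination (Nat.le_add_right k e) _
        (fun l => ((Fin.append (0 : Fin k → ℤ) y.1 l : ℤ) : ℝ))
        (fun j => Pi.single (Fin.castAdd e j) 1) fun i => ⟨fun j => y.2 i j + (i : ℕ) * N, ?_⟩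
      intro l
      refine Fin.addCases (fun l => ?_) (fun l => ?_) l
      · simp [Pi.single_apply, Fin.append_left, (Fin.castAdd_injective k e).eq_iff]
      · have : ∀ j : Fin k, Fin.natAdd k l ≠ Fin.castAdd e j := by
          intro j h
          have := congrArg Fin.val h
          simp at this
          omega
        simp [Fin.append_right, this]
    · intro i i' hii
      have h3 := congrFun hii (Fin.castAdd e ⟨0, hk⟩)
      simp only [Fin.append_left] at h3
      have h4 := h2 i ⟨0, hk⟩
      have h5 := h2 i' ⟨0, hk⟩
      by_contra hne
      rcases lt_or_gt_of_ne fun h : (i : ℕ) = i' => hne (Fin.ext h) with h | h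
      · have h6 : ((i : ℕ) : ℤ) + 1 ≤ (i' : ℕ) := by exact_mod_cast h
        nlinarith
      · have h6 : ((i' : ℕ) : ℤ) + 1 ≤ (i : ℕ) := by exact_mod_cast h
        nlinarith
  · intro y _ y' _ h
    have hfun := fun i l => congrFun (congrFun h i) l
    refine Prod.ext ?_ ?_
    · funext l
      have := hfun ⟨0, hr⟩ (Fin.natAdd k l)
      simpa [Fin.append_right] using this
    · funext i l
      have := hfun i (Fin.castAdd e l)
      simpa [Fin.append_left] using this

/-- Tuples containing an arithmetic progression with `e + 1` terms. -/
theorem le_card_affineInjTuples_progression (k d e N n : ℕ) (hd : k + 1 ≤ d)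
    (he : 1 ≤ e) (hN : (k + e + 2) * N ≤ n) :
    N ^ (d * (k + 2)) ≤ (affineInjTuples n d (k + 1) (k + (e + 1))).card := by
  have hcard : (latticeCube N d ×ˢ latticeCube N d ×ˢ
      Fintype.piFinset fun _ : Fin k => latticeCube N d).card = N ^ (d * (k + 2)) := by
    rw [Finset.card_product, Finset.card_product, Fintype.card_piFinset, Finset.prod_const,
      card_latticeCube, Finset.card_univ, Fintype.card_fin, ← pow_mul]
    ring
  rw [← hcard]
  refine Finset.card_le_card_of_injOn
    -- Relative to `y.1`, the progression has coordinates at most `e * N`, while the `i`-th free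
    -- point lies above `(e + 1 + i) * N` and at most `N` beyond. So all points are distinct, and
    -- coordinates stay below `(k + e + 2) * N`. Terms 0 and 1 of the progression recover its start
    -- and step.
    (fun y => Fin.append (fun (i : Fin k) l => y.1 l + (y.2.2 i l + (e + 1 + (i : ℕ)) * N))
      (fun (j : Fin (e + 1)) l => y.1 l + (j : ℕ) * y.2.1 l)) (fun y hy => ?_) ?_
  · obtain ⟨h1, h2⟩ := Finset.mem_product.mp hy
    obtain ⟨h2, h3⟩ := Finset.mem_product.mp h2
    rw [Fintype.mem_piFinset] at h3
    simp only [mem_latticeCube] at h1 h2 h3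
    zify at hN
    refine mem_affineInjTuples.mpr ⟨⟨fun i => mem_latticeCube.mpr fun l => ?_, ?_⟩, ?_⟩
    · have h1 := h1 l
      have h2 := h2 l
      refine Fin.addCases (fun i => ?_) (fun j => ?_) i
      · simp only [Fin.append_left]
        have h3 := h3 i l
        have hi : ((i : ℕ) : ℤ) + 1 ≤ k := by exact_mod_cast i.2
        constructor <;> nlinarith
      · simp only [Fin.append_right]
        have hj : ((j : ℕ) : ℤ) ≤ e := by exact_mod_cast Nat.lt_succ_iff.mp j.2
        constructor <;> nlinarith
    · refine liesInAffine_of_combination hd _ (fun l => y.1 l)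
        (Fin.cons (fun l => y.2.1 l) fun i l => y.2.2 i l + (e + 1 + (i : ℕ)) * N) fun i => ?_
      refine Fin.addCases (fun i => ?_) (fun j => ?_) i
      · refine ⟨Pi.single i.succ 1, fun l => ?_⟩
        simp [Fin.append_left, Pi.single_apply]
      · refine ⟨Pi.single 0 (j : ℕ), fun l => ?_⟩
        simp [Fin.append_right, Pi.single_apply]
    · have hl0 : 0 < d := by omega
      have h1 := h1 ⟨0, hl0⟩
      have h2 := h2 ⟨0, hl0⟩
      have h3 := fun i => h3 i ⟨0, hl0⟩
      rw [Fin.append_injective_iff]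
      refine ⟨fun i i' h => ?_, fun j j' h => ?_, fun i j h => ?_⟩
      · have h4 := congrFun h ⟨0, hl0⟩
        have h5 := h3 i
        have h6 := h3 i'
        dsimp only at h4
        by_contra hne
        rcases lt_or_gt_of_ne fun h : (i : ℕ) = i' => hne (Fin.ext h) with h | h
        · have h7 : ((i : ℕ) : ℤ) + 1 ≤ (i' : ℕ) := by exact_mod_cast h
          nlinarith
        · have h7 : ((i' : ℕ) : ℤ) + 1 ≤ (i : ℕ) := by exact_mod_cast h
          nlinarith
      · have h4 := congrFun h ⟨0, hl0⟩
        dsimp only at h4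
        have h5 := mul_right_cancel₀ (by omega : y.2.1 ⟨0, hl0⟩ ≠ 0) (add_left_cancel h4)
        exact Fin.ext (by exact_mod_cast h5)
      · have h4 := congrFun h ⟨0, hl0⟩
        have h5 := h3 i
        have hj : ((j : ℕ) : ℤ) ≤ e := by exact_mod_cast Nat.lt_succ_iff.mp j.2
        have hi : (0 : ℤ) ≤ (i : ℕ) := by positivity
        nlinarith
  · intro y _ y' _ h
    have hfun := fun i l => congrFun (congrFun h i) l
    have hx : y.1 = y'.1 := by
      funext l
      have := hfun (Fin.natAdd k 0) l
      simpa [Fin.append_right] using this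
    refine Prod.ext hx (Prod.ext ?_ ?_)
    · funext l
      have := hfun (Fin.natAdd k ⟨1, by omega⟩) l
      simp only [Fin.append_right, hx] at this
      simpa using this
    · funext i l
      have := hfun (Fin.castAdd (e + 1) i) l
      simpa [Fin.append_left, hx] using this

/-! ### Lower bound with a logarithm -/

/-- From `∑ φ(q) = n` over `q ∣ n`, the number `1 / n` is the sum of `φ(q) / q ^ 2 * (1 / f ^ 2)`
over `q * f = n`. Extending to all `q, f ≤ Q` factors the sum, and `∑ 1 / f ^ 2 ≤ 2`. -/
theorem sum_inv_le_two_mul_sum_totient (Q : ℕ) :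
    ∑ n ∈ Finset.Icc 1 Q, (1 : ℝ) / n ≤
      2 * ∑ q ∈ Finset.Icc 1 Q, (Nat.totient q : ℝ) / (q : ℝ) ^ 2 := by
  have h1 : ∀ n ∈ Finset.Icc 1 Q, (1 : ℝ) / n = ∑ x ∈ n.divisorsAntidiagonal,
      (Nat.totient x.1 : ℝ) / (x.1 : ℝ) ^ 2 * (1 / (x.2 : ℝ) ^ 2) := by
    intro n hn
    have hn0 : (n : ℝ) ≠ 0 := by
      have : n ≠ 0 := by have := Finset.mem_Icc.mp hn; omega
      exact_mod_cast this
    have h2 : ∀ x ∈ n.divisorsAntidiagonal, (Nat.totient x.1 : ℝ) / (x.1 : ℝ) ^ 2 *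
        (1 / (x.2 : ℝ) ^ 2) = (Nat.totient x.1 : ℝ) * (1 / (n : ℝ) ^ 2) := by
      intro x hx
      rw [← (Nat.mem_divisorsAntidiagonal.mp hx).1]
      push_cast
      rw [mul_pow, div_mul_div_comm, mul_one, mul_one_div]
    rw [Finset.sum_congr rfl h2, ← Finset.sum_mul,
      Nat.sum_divisorsAntidiagonal (fun i _ => (Nat.totient i : ℝ)), ← Nat.cast_sum, Nat.sum_totient]
    field_simp
  have hdisj : Set.PairwiseDisjoint (Finset.Icc 1 Q : Set ℕ) Nat.divisorsAntidiagonal := by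
    intro a _ b _ hab
    refine Finset.disjoint_left.mpr fun x hxa hxb => hab ?_
    rw [← (Nat.mem_divisorsAntidiagonal.mp hxa).1, ← (Nat.mem_divisorsAntidiagonal.mp hxb).1]
  rw [Finset.sum_congr rfl h1, ← Finset.sum_biUnion hdisj]
  have hsub : (Finset.Icc 1 Q).biUnion Nat.divisorsAntidiagonal ⊆
      Finset.Icc 1 Q ×ˢ Finset.Icc 1 Q := by
    intro x hx
    obtain ⟨n, hn, hx⟩ := Finset.mem_biUnion.mp hx
    obtain ⟨hxn, hn0⟩ := Nat.mem_divisorsAntidiagonal.mp hx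
    have hnQ := (Finset.mem_Icc.mp hn).2
    have h3 : x.1 ≠ 0 := by rintro h; simp [h] at hxn; omega
    have h4 : x.2 ≠ 0 := by rintro h; simp [h] at hxn; omega
    have h5 : x.1 ≤ x.1 * x.2 := Nat.le_mul_of_pos_right _ (by omega)
    have h6 : x.2 ≤ x.1 * x.2 := Nat.le_mul_of_pos_left _ (by omega)
    simp only [Finset.mem_product, Finset.mem_Icc]
    omega
  refine (Finset.sum_le_sum_of_subset_of_nonneg hsub fun _ _ _ => by positivity).trans ?_
  rw [Finset.sum_product]
  dsimp only
  rw [← Finset.sum_mul_sum, mul_comm]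
  gcongr
  rcases Nat.eq_zero_or_pos Q with rfl | hQ
  · simp
  rw [← Finset.add_sum_Ioc_eq_sum_Icc hQ]
  have := sum_one_div_sq_le 1 Q le_rfl
  norm_num at this ⊢
  linarith

/-- Integer vectors close to large multiples of distinct coordinate vectors are linearly
independent. -/
theorem eq_zero_of_combination_eq_zero {k e N : ℕ} (A : Fin k → Fin (k + e) → ℤ)
    (hA : ∀ i l, (if l = Fin.castAdd e i then (k * N : ℤ) else 0) + 1 ≤ A i l ∧
      A i l ≤ (if l = Fin.castAdd e i then (k * N : ℤ) else 0) + N)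
    (z : Fin k → ℤ) (hz : ∀ l, ∑ i, z i * A i l = 0) : z = 0 := by
  rcases Nat.eq_zero_or_pos k with rfl | hk
  · exact Subsingleton.elim _ _
  have : Nonempty (Fin k) := ⟨⟨0, hk⟩⟩
  -- Diagonal dominance: in coordinate `i₀` the vector `A i₀` has an entry above `k * N`, and the
  -- other `k - 1` vectors have entries at most `N`.
  obtain ⟨i₀, hi₀⟩ := Finite.exists_max fun i => |z i|
  have h1 := hz (Fin.castAdd e i₀)
  rw [← Finset.add_sum_erase _ _ (Finset.mem_univ i₀)] at h1
  have h2 : |∑ i ∈ Finset.univ.erase i₀, z i * A i (Fin.castAdd e i₀)| ≤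
      ((k - 1 : ℕ) : ℤ) * (|z i₀| * N) := by
    refine (Finset.abs_sum_le_sum_abs _ _).trans ?_
    refine (Finset.sum_le_card_nsmul _ _ (|z i₀| * N) fun i hi => ?_).trans (by simp)
    have h3 := hA i (Fin.castAdd e i₀)
    have h4 : Fin.castAdd e i₀ ≠ Fin.castAdd e i := fun h =>
      Finset.ne_of_mem_erase hi (Fin.castAdd_injective k e h).symm
    rw [if_neg h4, zero_add, zero_add] at h3
    rw [abs_mul, abs_of_pos (by omega : 0 < A i (Fin.castAdd e i₀))]
    exact mul_le_mul (hi₀ i) h3.2 (by omega) (abs_nonneg _)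
  have h5 : |z i₀| * (k * N + 1) ≤ |z i₀ * A i₀ (Fin.castAdd e i₀)| := by
    have h3 := hA i₀ (Fin.castAdd e i₀)
    rw [if_pos rfl] at h3
    rw [abs_mul]
    refine mul_le_mul_of_nonneg_left (h3.1.trans (le_abs_self _)) (abs_nonneg _)
  rw [eq_neg_of_add_eq_zero_left h1, abs_neg] at h5
  have h6 : ((k - 1 : ℕ) : ℤ) ≤ k := by omega
  have h7 : ((k - 1 : ℕ) : ℤ) * (|z i₀| * N) ≤ k * (|z i₀| * N) := by gcongr
  have h8 : |z i₀| ≤ 0 := by nlinarith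
  funext i
  exact abs_nonpos_iff.mp ((hi₀ i).trans h8)

/-- Vectors `a_0, …, a_k`, with `a_i` close to a multiple of the `i`-th coordinate vector, such
that `a_0 + ∑ i, c i • a_{i + 1}` is divisible by `q`. -/
def divisibleFrame {k e : ℕ} (N q : ℕ) (c : Fin k → ℕ) (a : Fin k → Fin (k + 1 + e) → ℤ)
    (w : Fin (k + 1 + e) → ℕ) : Fin (k + 1) → Fin (k + 1 + e) → ℤ :=
  Fin.cons
    (fun l => (if l = Fin.castAdd e 0 then ((k + 1 : ℕ) * N : ℤ) else 0) + 1 +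
      ((-1 - (if l = Fin.castAdd e 0 then ((k + 1 : ℕ) * N : ℤ) else 0) -
        ∑ i, c i * ((if l = Fin.castAdd e i.succ then ((k + 1 : ℕ) * N : ℤ) else 0) + a i l)) % q) +
      q * w l)
    (fun i l => (if l = Fin.castAdd e i.succ then ((k + 1 : ℕ) * N : ℤ) else 0) + a i l)

/-- In the vector of index 0 a residue below `q` is added to `q * w l` with `w l < N / q`, and the
total is below `N`. -/
theorem divisibleFrame_bounds {k e N q : ℕ} (hq : 1 ≤ q) {c : Fin k → ℕ}
    {a : Fin k → Fin (k + 1 + e) → ℤ} {w : Fin (k + 1 + e) → ℕ}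
    (ha : ∀ i, a i ∈ latticeCube N (k + 1 + e)) (hw : ∀ l, w l < N / q) (i : Fin (k + 1))
    (l : Fin (k + 1 + e)) :
    (if l = Fin.castAdd e i then ((k + 1 : ℕ) * N : ℤ) else 0) + 1 ≤ divisibleFrame N q c a w i l ∧
      divisibleFrame N q c a w i l ≤
        (if l = Fin.castAdd e i then ((k + 1 : ℕ) * N : ℤ) else 0) + N := by
  refine Fin.cases ?_ (fun i => ?_) i
  · simp only [divisibleFrame, Fin.cons_zero]
    generalize -1 - (if l = Fin.castAdd e 0 then ((k + 1 : ℕ) * N : ℤ) else 0) -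
      ∑ i, c i * ((if l = Fin.castAdd e i.succ then ((k + 1 : ℕ) * N : ℤ) else 0) + a i l) = y
    have h1 := Int.emod_nonneg y (by omega : (q : ℤ) ≠ 0)
    have h2 := Int.emod_lt_of_pos y (by omega : (0 : ℤ) < q)
    have h3 : q * (w l + 1) ≤ N := by
      have h4 := hw l
      calc q * (w l + 1) ≤ q * (N / q) := by gcongr; omega
        _ ≤ N := Nat.mul_div_le N q
    zify at h3
    have h5 : (0 : ℤ) ≤ q * w l := by positivity
    constructor <;> linarith
  · simp only [divisibleFrame, Fin.cons_succ]
    have := mem_latticeCube.mp (ha i) l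
    omega

/-- The residue in the vector of index 0 is chosen to cancel the rest modulo `q`; adding `q * w l`
changes nothing. -/
theorem dvd_divisibleFrame {k e N q : ℕ} {c : Fin k → ℕ} {a : Fin k → Fin (k + 1 + e) → ℤ}
    {w : Fin (k + 1 + e) → ℕ} (l : Fin (k + 1 + e)) :
    (q : ℤ) ∣ ∑ i, ((Fin.cons 1 c : Fin (k + 1) → ℕ) i : ℤ) * divisibleFrame N q c a w i l := by
  rw [Fin.sum_univ_succ]
  simp only [divisibleFrame, Fin.cons_zero, Fin.cons_succ]
  set S := ∑ i, (c i : ℤ) *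
    ((if l = Fin.castAdd e i.succ then ((k + 1 : ℕ) * N : ℤ) else 0) + a i l)
  set y := -1 - (if l = Fin.castAdd e 0 then ((k + 1 : ℕ) * N : ℤ) else 0) - S with hy
  have h1 := Int.emod_add_mul_ediv y q
  refine ⟨w l - y / q, ?_⟩
  push_cast at *
  linarith

/-- The coordinates, reduced modulo `q`, of a multiple of the vector `(1, c)`. -/
def frameCoeff {k e : ℕ} (q s : ℕ) (c : Fin k → ℕ) (t : Fin e → ℕ) (j : Fin (e + 1))
    (i : Fin (k + 1)) : ℕ :=
  ((Fin.cons s t : Fin (e + 1) → ℕ) j * (Fin.cons 1 c : Fin (k + 1) → ℕ) i) % q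

/-- The integer points in the span of the frame that the coefficients `frameCoeff` define. -/
def framePoint {k e d : ℕ} (q s : ℕ) (c : Fin k → ℕ) (t : Fin e → ℕ)
    (A : Fin (k + 1) → Fin d → ℤ) (j : Fin (e + 1)) (l : Fin d) : ℤ :=
  (∑ i, (frameCoeff q s c t j i : ℤ) * A i l) / q

/-- The division defining `framePoint` is exact: a multiple of `(1, c)` gives a sum divisible by
`q`, and so does its reduction modulo `q`. -/
theorem mul_framePoint {k e d q s : ℕ} {c : Fin k → ℕ} {t : Fin e → ℕ}
    {A : Fin (k + 1) → Fin d → ℤ}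
    (hA : ∀ l, (q : ℤ) ∣ ∑ i, ((Fin.cons 1 c : Fin (k + 1) → ℕ) i : ℤ) * A i l)
    (j : Fin (e + 1)) (l : Fin d) :
    (q : ℤ) * framePoint q s c t A j l = ∑ i, (frameCoeff q s c t j i : ℤ) * A i l := by
  refine Int.mul_ediv_cancel' ?_
  have h1 : (q : ℤ) ∣ ∑ i, (((Fin.cons s t : Fin (e + 1) → ℕ) j *
      (Fin.cons 1 c : Fin (k + 1) → ℕ) i : ℕ) : ℤ) * A i l := by
    have h2 := (hA l).mul_left ((Fin.cons s t : Fin (e + 1) → ℕ) j : ℤ)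
    rw [Finset.mul_sum] at h2
    simpa only [Nat.cast_mul, mul_assoc] using h2
  refine (Int.dvd_iff_dvd_of_dvd_sub ?_).mpr h1
  rw [← Finset.sum_sub_distrib]
  refine Finset.dvd_sum fun i _ => ?_
  rw [← sub_mul]
  refine Dvd.dvd.mul_right ?_ _
  rw [frameCoeff, Int.natCast_mod]
  exact dvd_sub_comm.mp Int.dvd_self_sub_emod

/-- The points determine their parameters. -/
theorem frame_parameters_unique {k e d q q' s s' : ℕ} {c c' : Fin k → ℕ} {t t' : Fin e → ℕ}
    {A : Fin (k + 1) → Fin d → ℤ}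
    (hind : ∀ z : Fin (k + 1) → ℤ, (∀ l, ∑ i, z i * A i l = 0) → z = 0)
    (hs : s < q) (hs' : s' < q') (hqs : q.Coprime s) (hqs' : q'.Coprime s')
    (hc : ∀ i, c i < q) (hc' : ∀ i, c' i < q') (ht : ∀ j, t j < q) (ht' : ∀ j, t' j < q')
    (hA : ∀ l, (q : ℤ) ∣ ∑ i, ((Fin.cons 1 c : Fin (k + 1) → ℕ) i : ℤ) * A i l)
    (hA' : ∀ l, (q' : ℤ) ∣ ∑ i, ((Fin.cons 1 c' : Fin (k + 1) → ℕ) i : ℤ) * A i l)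
    (h : ∀ j l, framePoint q s c t A j l = framePoint q' s' c' t' A j l) :
    q = q' ∧ s = s' ∧ c = c' ∧ t = t' := by
  -- Independence of the frame allows comparing coefficients after clearing denominators.
  have key : ∀ j i, q' * frameCoeff q s c t j i = q * frameCoeff q' s' c' t' j i := by
    intro j i
    have h1 := hind (fun i => (q' * frameCoeff q s c t j i : ℤ) - q * frameCoeff q' s' c' t' j i) (by
      intro l
      have h2 := mul_framePoint (s := s) (t := t) hA j l
      have h3 := mul_framePoint (s := s') (t := t') hA' j l
      simp only [sub_mul, mul_assoc, Finset.sum_sub_distrib, ← Finset.mul_sum]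
      rw [← h2, ← h3, h j l]
      ring)
    have h2 := congrFun h1 i
    simp only [Pi.zero_apply] at h2
    exact_mod_cast sub_eq_zero.mp h2
  -- This entry reads `s / q = s' / q'`, with both fractions in lowest terms.
  have h00 := key 0 0
  simp only [frameCoeff, Fin.cons_zero, mul_one, Nat.mod_eq_of_lt hs, Nat.mod_eq_of_lt hs'] at h00
  have hqq : q = q' := by
    refine Nat.dvd_antisymm ?_ ?_
    · exact hqs.dvd_of_dvd_mul_right ⟨s', h00⟩
    · exact hqs'.dvd_of_dvd_mul_right ⟨s, h00.symm⟩
  subst hqq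
  have hq : 0 < q := by omega
  have key' : ∀ j i, frameCoeff q s c t j i = frameCoeff q s' c' t' j i := fun j i =>
    Nat.eq_of_mul_eq_mul_left hq (key j i)
  have hss : s = s' := Nat.eq_of_mul_eq_mul_left hq h00
  subst hss
  refine ⟨rfl, rfl, ?_, ?_⟩
  · funext i
    -- Row 0 contains `s * c i` modulo `q` with `s` invertible; column 0 contains the `t j`.
    have h1 := key' 0 i.succ
    simp only [frameCoeff, Fin.cons_zero, Fin.cons_succ] at h1
    have h2 : c i ≡ c' i [MOD q] := Nat.ModEq.cancel_left_of_coprime hqs h1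
    exact Nat.ModEq.eq_of_lt_of_lt h2 (hc i) (hc' i)
  · funext j
    have h1 := key' j.succ 0
    simpa only [frameCoeff, Fin.cons_zero, Fin.cons_succ, mul_one, Nat.mod_eq_of_lt (ht j),
      Nat.mod_eq_of_lt (ht' j)] using h1

/-- The factors count, for each `q`, the choices of `s`, `c`, `t`, the base point, the `k` free
frame vectors and the multiples `w`. The tuple consists of the base point, its translates by the
frame vectors, and `e + 1` frame points. Coordinates are at most `N + (k + 1) * (k + 2) * N ≤ (k +
2) ^ 2 * N`. -/
theorem sum_totient_le_card_affineTuples (k e N n : ℕ) (hN : (k + 2) ^ 2 * N ≤ n) :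
    ∑ q ∈ Finset.Icc 1 N, Nat.totient q * (q ^ k * (q ^ e * (N ^ (k + 1 + (e + 1)) *
        ((N ^ (k + 1 + (e + 1))) ^ k * (N / q) ^ (k + 1 + (e + 1)))))) ≤
      (affineTuples n (k + 1 + (e + 1)) (k + 1) (k + 1 + (e + 1) + 1)).card := by
  set d := k + 1 + (e + 1) with hd
  set P : Finset ((_ : ℕ) × (ℕ × (Fin k → ℕ) × (Fin e → ℕ) × (Fin d → ℤ) ×
      (Fin k → Fin d → ℤ) × (Fin d → ℕ))) :=
    (Finset.Icc 1 N).sigma fun q => ((Finset.range q).filter q.Coprime) ×ˢ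
      (Fintype.piFinset fun _ => Finset.range q) ×ˢ (Fintype.piFinset fun _ => Finset.range q) ×ˢ
      latticeCube N d ×ˢ (Fintype.piFinset fun _ => latticeCube N d) ×ˢ
      (Fintype.piFinset fun _ => Finset.range (N / q)) with hP
  have hcard : P.card = ∑ q ∈ Finset.Icc 1 N, Nat.totient q * (q ^ k * (q ^ e * (N ^ d *
        ((N ^ d) ^ k * (N / q) ^ d)))) := by
    simp only [hP, Finset.card_sigma, Finset.card_product, Fintype.card_piFinset,
      Finset.card_range, Finset.prod_const, card_latticeCube, Finset.card_univ, Fintype.card_fin,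
      Nat.totient_eq_card_coprime]
  have hmem : ∀ y ∈ P, (1 ≤ y.1 ∧ y.1 ≤ N) ∧ (y.2.1 < y.1 ∧ y.1.Coprime y.2.1) ∧
      (∀ i, y.2.2.1 i < y.1) ∧ (∀ j, y.2.2.2.1 j < y.1) ∧ y.2.2.2.2.1 ∈ latticeCube N d ∧
      (∀ i, y.2.2.2.2.2.1 i ∈ latticeCube N d) ∧ ∀ l, y.2.2.2.2.2.2 l < N / y.1 := by
    intro y hy
    simpa only [hP, Finset.mem_sigma, Finset.mem_product, Finset.mem_Icc, Finset.mem_filter,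
      Finset.mem_range, Fintype.mem_piFinset] using hy
  rw [← hcard]
  refine Finset.card_le_card_of_injOn (fun y => Fin.cons y.2.2.2.2.1 (Fin.append
      (fun i l => y.2.2.2.2.1 l + divisibleFrame N y.1 y.2.2.1 y.2.2.2.2.2.1 y.2.2.2.2.2.2 i l)
      (fun j l => y.2.2.2.2.1 l + framePoint y.1 y.2.1 y.2.2.1 y.2.2.2.1
        (divisibleFrame N y.1 y.2.2.1 y.2.2.2.2.2.1 y.2.2.2.2.2.2) j l)))
    (fun y hy => ?_) fun y hy y' hy' h => ?_
  · obtain ⟨q, s, c, t, x, a, w⟩ := y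
    obtain ⟨⟨hq, -⟩, -, -, -, hx, ha, hw⟩ := hmem _ hy
    dsimp only at hq hx ha hw ⊢
    have hb := divisibleFrame_bounds (e := e + 1) hq (c := c) ha hw
    have hpt := mul_framePoint (s := s) (t := t)
      (dvd_divisibleFrame (e := e + 1) (N := N) (q := q) (c := c) (a := a) (w := w))
    set A := divisibleFrame (e := e + 1) N q c a w
    have hx := mem_latticeCube.mp hx
    have hA : ∀ i l, 0 ≤ A i l ∧ A i l ≤ (k + 2) * N := by
      intro i l
      have h1 := hb i l
      split_ifs at h1
      · push_cast at h1
        constructor <;> nlinarith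
      · constructor <;> nlinarith
    zify at hN
    refine mem_affineTuples.mpr ⟨fun i => mem_latticeCube.mpr fun l => ?_, ?_⟩
    · have h0 := hx l
      have hN0 : (0 : ℤ) ≤ N := by positivity
      have hN1 : (0 : ℤ) ≤ k * N := by positivity
      have hN2 : (0 : ℤ) ≤ k * (k * N) := by positivity
      refine Fin.cases ?_ (fun i => ?_) i
      · simp only [Fin.cons_zero]
        constructor <;> nlinarith
      · simp only [Fin.cons_succ]
        refine Fin.addCases (fun i => ?_) (fun j => ?_) i
        · simp only [Fin.append_left]
          have h1 := hA i l
          constructor <;> nlinarith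
        · simp only [Fin.append_right]
          have hq0 : (0 : ℤ) < q := by exact_mod_cast hq
          have h1 : 0 ≤ (q : ℤ) * framePoint q s c t A j l := by
            rw [hpt]
            exact Finset.sum_nonneg fun i _ => mul_nonneg (by positivity) (hA i l).1
          have h2 : (q : ℤ) * framePoint q s c t A j l ≤ q * ((k + 1) * ((k + 2) * N)) := by
            rw [hpt]
            refine (Finset.sum_le_card_nsmul _ _ (q * ((k + 2) * N) : ℤ) fun i _ => ?_).trans
              (le_of_eq ?_)
            · have h3 : (frameCoeff q s c t j i : ℤ) ≤ q := by
                exact_mod_cast (Nat.mod_lt _ hq).le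
              exact mul_le_mul h3 (hA i l).2 (hA i l).1 hq0.le
            · simp
              ring
          have h3 := nonneg_of_mul_nonneg_right h1 hq0
          have h4 := le_of_mul_le_mul_left h2 hq0
          constructor <;> nlinarith
    · refine liesInAffine_of_combination (by omega) _ (fun l => x l) (fun i l => A i l) fun i => ?_
      refine Fin.cases ⟨0, by simp⟩ (fun i => ?_) i
      refine Fin.addCases (fun i => ⟨Pi.single i 1, fun l => ?_⟩) (fun j =>
        ⟨fun i => (frameCoeff q s c t j i : ℝ) / q, fun l => ?_⟩) i
      · simp [Fin.append_left, Pi.single_apply]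
      · have hq0 : (q : ℝ) ≠ 0 := by
          have : q ≠ 0 := by omega
          exact_mod_cast this
        have h1 : (q : ℝ) * (framePoint q s c t A j l : ℝ) =
            ∑ i, (frameCoeff q s c t j i : ℝ) * (A i l : ℝ) := by
          exact_mod_cast hpt j l
        simp only [Fin.cons_succ, Fin.append_right, Int.cast_add]
        congr 1
        rw [eq_comm, ← mul_right_inj' hq0, h1, Finset.mul_sum]
        refine Finset.sum_congr rfl fun i _ => ?_
        field_simp
  · obtain ⟨q, s, c, t, x, a, w⟩ := y
    obtain ⟨q', s', c', t', x', a', w'⟩ := y'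
    obtain ⟨⟨hq, -⟩, ⟨hs, hqs⟩, hc, ht, -, ha, hw⟩ := hmem _ hy
    obtain ⟨⟨hq', -⟩, ⟨hs', hqs'⟩, hc', ht', -, ha', hw'⟩ := hmem _ hy'
    dsimp only at hq hs hqs hc ht ha hw hq' hs' hqs' hc' ht' ha' hw' h
    have hfun := fun i l => congrFun (congrFun h i) l
    have hx : x = x' := by
      funext l
      simpa using hfun 0 l
    subst hx
    have hA : divisibleFrame (e := e + 1) N q c a w = divisibleFrame (e := e + 1) N q' c' a' w' := by
      funext i l
      have h1 := hfun (Fin.castAdd (e + 1) i).succ l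
      simp only [Fin.cons_succ, Fin.append_left] at h1
      exact add_left_cancel h1
    have hv : ∀ j l, framePoint q s c t (divisibleFrame (e := e + 1) N q c a w) j l =
        framePoint q' s' c' t' (divisibleFrame (e := e + 1) N q c a w) j l := by
      intro j l
      have h1 := hfun (Fin.natAdd (k + 1) j).succ l
      simp only [Fin.cons_succ, Fin.append_right] at h1
      rw [← hA] at h1
      exact add_left_cancel h1
    have hb := divisibleFrame_bounds (e := e + 1) hq (c := c) ha hw
    have hdvd' := dvd_divisibleFrame (e := e + 1) (N := N) (q := q') (c := c') (a := a') (w := w')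
    rw [← hA] at hdvd'
    obtain ⟨rfl, rfl, rfl, rfl⟩ := frame_parameters_unique
      (eq_zero_of_combination_eq_zero _ hb) hs hs' hqs hqs' hc hc' ht ht' dvd_divisibleFrame
      hdvd' hv
    have haa : a = a' := by
      funext i l
      have h1 := congrFun (congrFun hA i.succ) l
      simpa only [divisibleFrame, Fin.cons_succ, add_right_inj] using h1
    subst haa
    have hww : w = w' := by
      funext l
      have h1 := congrFun (congrFun hA 0) l
      simp only [divisibleFrame, Fin.cons_zero, add_right_inj] at h1
      have hq0 : (q : ℤ) ≠ 0 := by omega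
      exact_mod_cast mul_left_cancel₀ hq0 h1
    subst hww
    rfl

theorem le_card_affineTuples_of_eq (k e : ℕ) : ∃ c : ℝ, 0 < c ∧ ∀ᶠ n : ℕ in atTop,
    c * ((n : ℝ) ^ ((k + 1 + (e + 1)) * (k + 1 + 1)) * Real.log n) ≤
      ((affineTuples n (k + 1 + (e + 1)) (k + 1) (k + 1 + (e + 1) + 1)).card : ℝ) := by
  set d := k + 1 + (e + 1) with hd
  set M := (k + 2) ^ 2 with hM
  have hM1 : 1 ≤ M := Nat.one_le_pow _ _ (by omega)
  refine ⟨(1 / (2 * M)) ^ (d * (k + 1 + 1)) * (1 / 2) ^ d * (1 / 4), by positivity, ?_⟩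
  -- From `M ^ 2 ≤ n` follows `log (n / M) ≥ log n / 2`.
  filter_upwards [eventually_ge_atTop (M ^ 2)] with n hn
  have hMn : M ≤ n := le_trans (by nlinarith) hn
  set N := n / M with hN
  have hMN : M * N ≤ n := Nat.mul_div_le n M
  have h1 := sum_totient_le_card_affineTuples k e N n hMN
  rw [← hd] at h1
  have hN0 : (n : ℝ) / (2 * M) ≤ N := div_two_mul_le_natDiv hM1 hMn
  have hM0 : (0 : ℝ) < M := by exact_mod_cast hM1
  have hn0 : (0 : ℝ) < n := by exact_mod_cast (by omega : 0 < n)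
  have hlog : Real.log n / 2 ≤ ∑ q ∈ Finset.Icc 1 N, (1 : ℝ) / q := by
    have h2 : Real.log (N + 1 : ℕ) ≤ ∑ q ∈ Finset.Icc 1 N, (1 : ℝ) / q := by
      refine (log_add_one_le_harmonic N).trans (le_of_eq ?_)
      rw [harmonic_eq_sum_Icc]
      push_cast
      simp
    refine le_trans ?_ h2
    have h3 : (n : ℝ) / M ≤ (N + 1 : ℕ) := by
      rw [div_le_iff₀ hM0, mul_comm]
      exact_mod_cast (Nat.lt_mul_div_succ n hM1).le
    refine le_trans ?_ (Real.log_le_log (by positivity) h3)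
    rw [Real.log_div hn0.ne' hM0.ne']
    have h4 : Real.log ((M : ℝ) ^ 2) ≤ Real.log n :=
      Real.log_le_log (by positivity) (by exact_mod_cast hn)
    rw [Real.log_pow] at h4
    push_cast at h4
    linarith
  have hterm : ∀ q ∈ Finset.Icc 1 N, (N : ℝ) ^ (d * (k + 1 + 1)) * (1 / 2) ^ d *
      ((Nat.totient q : ℝ) / (q : ℝ) ^ 2) ≤ ((Nat.totient q * (q ^ k * (q ^ e * (N ^ d *
        ((N ^ d) ^ k * (N / q) ^ d)))) : ℕ) : ℝ) := by
    intro q hq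
    obtain ⟨hq1, hqN⟩ := Finset.mem_Icc.mp hq
    have hq0 : (0 : ℝ) < q := by exact_mod_cast hq1
    push_cast
    calc _ = (Nat.totient q : ℝ) * ((q : ℝ) ^ k * ((q : ℝ) ^ e * ((N : ℝ) ^ d *
          (((N : ℝ) ^ d) ^ k * ((N : ℝ) / (2 * q)) ^ d)))) := by
          -- Here `d = k + e + 2`, so the powers of `q` leave exactly `φ(q) / q ^ 2`.
          have h5 : (q : ℝ) ^ d = (q : ℝ) ^ k * (q : ℝ) ^ e * (q : ℝ) ^ 2 := by
            rw [hd]; ring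
          rw [div_pow (N : ℝ), mul_pow (2 : ℝ), h5, pow_mul, pow_succ, pow_succ, one_div, inv_pow]
          field_simp
      _ ≤ _ := by
          gcongr
          exact div_two_mul_le_natDiv hq1 hqN
  have hsum := Finset.sum_le_sum hterm
  rw [← Finset.mul_sum, ← Nat.cast_sum] at hsum
  have h6 := sum_inv_le_two_mul_sum_totient N
  have hlog0 : 0 ≤ Real.log n := Real.log_natCast_nonneg n
  calc _ = ((n : ℝ) / (2 * M)) ^ (d * (k + 1 + 1)) * (1 / 2) ^ d * (Real.log n / 4) := by
        rw [← one_div_mul_eq_div, mul_pow]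
        ring
    _ ≤ (N : ℝ) ^ (d * (k + 1 + 1)) * (1 / 2) ^ d *
        ∑ q ∈ Finset.Icc 1 N, (Nat.totient q : ℝ) / (q : ℝ) ^ 2 := by
        gcongr
        linarith
    _ ≤ _ := hsum.trans (by exact_mod_cast h1)

/-! ### Removing coincidences -/

/-- A tuple with two equal points is determined by their positions and the tuple with one of them
deleted. -/
theorem card_affineTuples_le_add (n d k m : ℕ) : (affineTuples n d k (m + 1)).card ≤
    (affineInjTuples n d k (m + 1)).card + (m + 1) ^ 2 * (affineTuples n d k m).card := by
  classical
  set F : Fin (m + 1) × Fin (m + 1) → Finset (Fin (m + 1) → Fin d → ℤ) := fun x =>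
    (affineTuples n d k (m + 1)).filter fun p => x.1 ≠ x.2 ∧ p x.1 = p x.2 with hF
  have hsub : affineTuples n d k (m + 1) ⊆
      affineInjTuples n d k (m + 1) ∪ Finset.univ.biUnion F := by
    intro p hp
    rw [Finset.mem_union]
    by_cases hinj : Function.Injective p
    · exact Or.inl (mem_affineInjTuples.mpr ⟨mem_affineTuples.mp hp, hinj⟩)
    · right
      simp only [Function.Injective, not_forall] at hinj
      obtain ⟨i, j, hij, hne⟩ := hinj
      exact Finset.mem_biUnion.mpr ⟨(i, j), Finset.mem_univ _, Finset.mem_filter.mpr ⟨hp, hne, hij⟩⟩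
  refine (Finset.card_le_card hsub).trans ((Finset.card_union_le _ _).trans ?_)
  gcongr
  refine Finset.card_biUnion_le.trans ?_
  refine (Finset.sum_le_card_nsmul _ _ (affineTuples n d k m).card fun x _ => ?_).trans (by
    simp [sq])
  refine Finset.card_le_card_of_injOn (fun p i => p (x.2.succAbove i)) (fun p hp => ?_)
    fun p hp p' hp' h => ?_
  · obtain ⟨hp, -⟩ := Finset.mem_filter.mp hp
    obtain ⟨hp, S, hS, hSk, hpS⟩ := mem_affineTuples.mp hp
    exact mem_affineTuples.mpr ⟨fun i => hp _, S, hS, hSk, fun i => hpS _⟩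
  · obtain ⟨-, hne, hp⟩ := Finset.mem_filter.mp hp
    obtain ⟨-, -, hp'⟩ := Finset.mem_filter.mp hp'
    have h1 : ∀ i, i ≠ x.2 → p i = p' i := by
      intro i hi
      obtain ⟨j, rfl⟩ := Fin.exists_succAbove_eq hi
      exact congrFun h j
    funext i
    by_cases hi : i = x.2
    · rw [hi, ← hp, ← hp', h1 _ hne]
    · exact h1 i hi

/-- Deleting a repeated point leaves `d` points, a case with the same power of `n` but no logarithm.
Once `log n` is large, coincidences take at most half of the lower bound. -/
theorem le_card_affineInjTuples_of_eq (k e : ℕ) : ∃ c : ℝ, 0 < c ∧ ∀ᶠ n : ℕ in atTop,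
    c * ((n : ℝ) ^ ((k + 1 + (e + 1)) * (k + 1 + 1)) * Real.log n) ≤
      ((affineInjTuples n (k + 1 + (e + 1)) (k + 1) (k + 1 + (e + 1) + 1)).card : ℝ) := by
  obtain ⟨c, hc, hlow⟩ := le_card_affineTuples_of_eq k e
  obtain ⟨C, hC, hup⟩ := card_affineTuples_le_of_ne (k + 1 + (e + 1)) (k + 1) (k + 1 + e)
    (by omega) (by omega)
  rw [show k + 1 + e + 1 = k + 1 + (e + 1) by omega] at hup
  set d := k + 1 + (e + 1) with hd
  have hlog := (Real.tendsto_log_atTop.comp tendsto_natCast_atTop_atTop).eventually_ge_atTop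
    (2 * ((d + 1) ^ 2 * C) / c)
  refine ⟨c / 2, by positivity, ?_⟩
  filter_upwards [hlow, hlog, eventually_ge_atTop 1] with n h1 h2 hn
  have h3 := hup n hn
  have h4 : ((affineTuples n d (k + 1) (d + 1)).card : ℝ) ≤
      (affineInjTuples n d (k + 1) (d + 1)).card +
        (d + 1) ^ 2 * (affineTuples n d (k + 1) d).card := by
    exact_mod_cast card_affineTuples_le_add n d (k + 1) d
  rw [show d + (k + 1) * max (k + 1 + e) d = d * (k + 1 + 1) by
    rw [max_eq_right (by omega)]; ring] at h3
  rw [Function.comp_apply, div_le_iff₀ hc] at h2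
  set L := (n : ℝ) ^ (d * (k + 1 + 1)) with hL
  have hL0 : 0 ≤ L := by positivity
  have h5 : (d + 1 : ℝ) ^ 2 * (affineTuples n d (k + 1) d).card ≤ (d + 1) ^ 2 * (C * L) := by
    gcongr
  nlinarith

/-! ### Assembling the bounds -/

theorem le_card_of_le_div_pow {f : ℕ → ℕ} (M E : ℕ) (hM : 1 ≤ M)
    (h : ∀ n, M ≤ n → (n / M) ^ E ≤ f n) :
    ∃ c : ℝ, 0 < c ∧ ∀ᶠ n : ℕ in atTop, c * (n : ℝ) ^ E ≤ f n := by
  have hM0 : (0 : ℝ) < M := by exact_mod_cast hM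
  refine ⟨(1 / (2 * M)) ^ E, by positivity, ?_⟩
  filter_upwards [eventually_ge_atTop M] with n hn
  calc _ = ((n : ℝ) / (2 * M)) ^ E := by rw [← mul_pow]; congr 1; ring
    _ ≤ ((n / M : ℕ) : ℝ) ^ E := by
      gcongr
      exact div_two_mul_le_natDiv hM hn
    _ ≤ _ := by exact_mod_cast h n hn

theorem le_card_affineInjTuples (d k m : ℕ) (hk : 1 ≤ k) (hkd : k < d) (hm : k + 1 ≤ m) :
    ∃ c : ℝ, 0 < c ∧ ∀ᶠ n : ℕ in atTop,
      c * affineRate d k (m + 1) n ≤ ((affineInjTuples n d k (m + 1)).card : ℝ) := by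
  rcases lt_trichotomy m d with h | rfl | h
  · obtain ⟨k, rfl⟩ : ∃ k', k = k' + 1 := ⟨k - 1, by omega⟩
    obtain ⟨e, rfl⟩ : ∃ e, m = k + e := ⟨m - k, by omega⟩
    simp only [affineRate, Nat.add_sub_cancel, if_pos h.ne, max_eq_right h.le]
    rw [show d + (k + 1) * d = d * (k + 2) by ring]
    exact le_card_of_le_div_pow (k + e + 2) _ (by omega) fun n _ =>
      le_card_affineInjTuples_progression k d e _ n (by omega) (by omega) (Nat.mul_div_le n _)
  · obtain ⟨k, rfl⟩ : ∃ k', k = k' + 1 := ⟨k - 1, by omega⟩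
    obtain ⟨e, rfl⟩ : ∃ e, m = k + 1 + (e + 1) := ⟨m - (k + 2), by omega⟩
    simpa only [affineRate, Nat.add_sub_cancel, ne_eq, not_true_eq_false, if_false] using
      le_card_affineInjTuples_of_eq k e
  · obtain ⟨e, rfl⟩ : ∃ e, d = k + e := ⟨d - k, by omega⟩
    simp only [affineRate, Nat.add_sub_cancel, if_pos h.ne', max_eq_left h.le]
    rw [show k + e + k * m = e + k * (m + 1) by ring]
    exact le_card_of_le_div_pow (m + 1) _ (by omega) fun n _ =>
      le_card_affineInjTuples_parallel k e (m + 1) _ n hk (by omega) (Nat.mul_div_le n _)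

theorem card_affineTuples_le (d k m : ℕ) (hk : 1 ≤ k) (hkd : k < d) :
    ∃ C : ℝ, ∀ᶠ n : ℕ in atTop,
      ((affineTuples n d k (m + 1)).card : ℝ) ≤ C * affineRate d k (m + 1) n := by
  by_cases h : m = d
  · subst h
    obtain ⟨k, rfl⟩ : ∃ k', k = k' + 1 := ⟨k - 1, by omega⟩
    obtain ⟨C, -, hC⟩ := card_affineTuples_le_of_eq m k (by omega)
    refine ⟨C, ?_⟩
    filter_upwards [eventually_ge_atTop 3] with n hn
    simpa only [affineRate, Nat.add_sub_cancel, ne_eq, not_true_eq_false, if_false] using hC n hn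
  · obtain ⟨C, -, hC⟩ := card_affineTuples_le_of_ne d k m (by omega) h
    refine ⟨C, ?_⟩
    filter_upwards [eventually_ge_atTop 1] with n hn
    simpa only [affineRate, Nat.add_sub_cancel, ne_eq, h, not_false_eq_true, if_true] using hC n hn

theorem affineRate_nonneg (d k r n : ℕ) : 0 ≤ affineRate d k r n := by
  have := Real.log_natCast_nonneg n
  rw [affineRate]
  split_ifs <;> positivity

theorem isTheta_of_eventually_le {f g : ℕ → ℝ} (hf : ∀ n, 0 ≤ f n) (hg : ∀ n, 0 ≤ g n) {c C : ℝ}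
    (hc : 0 < c) (hlow : ∀ᶠ n in atTop, c * g n ≤ f n) (hup : ∀ᶠ n in atTop, f n ≤ C * g n) :
    f =Θ[atTop] g := by
  refine ⟨IsBigO.of_bound C ?_, IsBigO.of_bound c⁻¹ ?_⟩
  · filter_upwards [hup] with n hn
    rwa [Real.norm_of_nonneg (hf n), Real.norm_of_nonneg (hg n)]
  · filter_upwards [hlow] with n hn
    rw [Real.norm_of_nonneg (hf n), Real.norm_of_nonneg (hg n)]
    rwa [le_inv_mul_iff₀ hc]

theorem proposition1p8 (d k r : ℕ) (hk : 1 ≤ k) (hkd : k < d) (hr : k + 2 ≤ r) :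
    ((fun n : ℕ => ((affineTuples n d k r).card : ℝ)) =Θ[atTop]
      fun n : ℕ => affineRate d k r n) ∧
    ((fun n : ℕ => ((affineInjTuples n d k r).card : ℝ)) =Θ[atTop]
      fun n : ℕ => affineRate d k r n) := by
  classical
  obtain ⟨m, rfl⟩ : ∃ m, r = m + 1 := ⟨r - 1, by omega⟩
  obtain ⟨c, hc, hlow⟩ := le_card_affineInjTuples d k m hk hkd (by omega)
  obtain ⟨C, hup⟩ := card_affineTuples_le d k m hk hkd
  have hle : ∀ n, ((affineInjTuples n d k (m + 1)).card : ℝ) ≤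
      (affineTuples n d k (m + 1)).card := fun n =>
    Nat.cast_le.mpr (Finset.card_le_card fun p hp =>
      mem_affineTuples.mpr (mem_affineInjTuples.mp hp).1)
  exact ⟨isTheta_of_eventually_le (fun n => Nat.cast_nonneg _) (affineRate_nonneg d k _) hc
      (hlow.mono fun n hn => hn.trans (hle n)) hup,
    isTheta_of_eventually_le (fun n => Nat.cast_nonneg _) (affineRate_nonneg d k _) hc hlow
      (hup.mono fun n hn => (hle n).trans hn)⟩
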